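/- **Setting.** Fix $\hbar>0$. Let $\mathcal H_r$ be a separable complex Hilbert space and let $H_r$ be a (possibly unbounded) self-adjoint operator on it. Let $\mathcal H_c=L^2(\mathbb R)$ be the space of the ideal clock, with generalized clock readings $|\tau\rangle$, $\langle\tau|\tau'\rangle=\delta(\tau-\tau')$, and clock Hamiltonian $H_c=-i\hbar\,\partial_\tau$ on $H^1(\mathbb R)$. Let $\mathcal H=\mathcal H_c\otimes\mathcal H_r=L^2(\mathbb R;\mathcal H_r)$, and let $H=H_c\otimes I_r+I_c\otimes H_r$ be the closure of this sum from the algebraic tensor product of the domains (a Page–Wootters system). A *history* of the system is a map $\psi:\mathbb R\to\mathcal H_r$ with values in the unit vectors such that $\psi(\tau')=e^{-\frac{i}{\hbar}H_r(\tau'-\tau)}\psi(\tau)$ for all $\tau,\tau'$. Its temporal states are the generalized vectors $|\tau\rangle|\psi(\tau)\rangle$, and its timeless state is the generalized vector $|\Psi\rangle\!\rangle=\int_{\mathbb R}|\tau\rangle|\psi(\tau)\rangle\,d\tau$; generalized vectors are functionals on the space $C_c(\mathbb R;\mathcal H_r)\subset\mathcal H$ of norm-continuous compactly supported functions, with $\langle\Phi|\,(|\tau\rangle|x\rangle)=\langle\Phi(\tau),x\rangle$.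 Two Page–Wootters systems with chosen histories, $(H,\psi)$ and $(H',\psi')$, are *equivalent as bare Page–Wootters systems* if there is a unitary $S:\mathcal H\to\mathcal H'$, mapping the test space $C_c(\mathbb R;\mathcal H_r)$ onto $C_c(\mathbb R;\mathcal H_r')$ (and hence extending to generalized vectors), such that $SHS^{-1}=H'$ (including domains), $S\,|\tau\rangle|\psi(\tau)\rangle=|\tau\rangle|\psi'(\tau)\rangle$ for every $\tau\in\mathbb R$, and $S|\Psi\rangle\!\rangle=|\Psi'\rangle\!\rangle$. **Corollary.** Let $\psi$ and $\psi'$ be two histories of the same Page–Wootters system, i.e. following the same evolution law $H_r$. Then $(H,\psi)$ and $(H,\psi')$ are equivalent as bare Page–Wootters systems. More explicitly, there is a unitary $S_0$ on $\mathcal H_r$ with $S_0\psi(0)=\psi'(0)$; and for every such $S_0$ the formula $$S=\int_{\mathbb R}|\tau\rangle\langle\tau|\otimes S_\tau\,d\tau,\qquad S_\tau=e^{-\frac{i}{\hbar}H_r\tau}\,S_0\,e^{\frac{i}{\hbar}H_r\tau},$$ i.e. $(S\Phi)(\tau)=S_\tau\Phi(\tau)$ for almost every $\tau$, defines a unitary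 operator on $\mathcal H$ which is such an equivalence: $S$ commutes with $H$ (that is, $SHS^{-1}=H$), $S\,|\tau\rangle|\psi(\tau)\rangle=|\tau\rangle|\psi'(\tau)\rangle$ for every $\tau\in\mathbb R$, and $S$ maps the timeless state of $\psi$ to that of $\psi'$. -/

import Mathlib

open MeasureTheory Filter Topology
open scoped ENNReal ContDiff CompactlySupported

noncomputable section

namespace PageWootters

/-! ## Unitary evolution generated by an unbounded self-adjoint operator -/

section Evolution

variable {E : Type*} [NormedAddCommGroup E] [InnerProductSpace ℂ E]

/-- `U` is the strongly continuous one-parameter unitary group `t ↦ exp(-i t A / ħ)`: it is a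
group, it is strongly continuous, and `-i A / ħ` is exactly its infinitesimal generator, that is,
`x ∈ D(A)` and `A x = y` if and only if `t ↦ U t x` is differentiable at `0` with derivative
`-(i / ħ) y`. -/
structure IsEvolutionGroup (hbar : ℝ) (A : E →ₗ.[ℂ] E) (U : ℝ → (E ≃ₗᵢ[ℂ] E)) : Prop where
  map_add : ∀ (s t : ℝ) (x : E), U (s + t) x = U s (U t x)
  continuous_orbit : ∀ x : E, Continuous fun t : ℝ => U t x
  generator : ∀ x y : E,
    (x, y) ∈ A.graph ↔ HasDerivAt (fun t : ℝ => U t x) ((-(Complex.I / (hbar : ℂ))) • y) 0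

open Classical in
/-- The unitary group `t ↦ exp(-i t A / ħ)` of an (unbounded) operator `A`. For `0 < ħ` and `A`
self-adjoint it exists and is unique by Stone's theorem; the value for operators which generate no
unitary group is irrelevant. -/
def evolution (hbar : ℝ) (A : E →ₗ.[ℂ] E) : ℝ → (E ≃ₗᵢ[ℂ] E) :=
  if h : ∃ U : ℝ → (E ≃ₗᵢ[ℂ] E), IsEvolutionGroup hbar A U then h.choose
  else fun _ => LinearIsometryEquiv.refl ℂ E

end Evolution

/-! ## The total Hilbert space `L²(ℝ) ⊗ E = L²(ℝ; E)` -/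

/-- The Hilbert space `L²(ℝ; E)`. For `E = ℂ` it is the space of the ideal clock; for `E` the
space of the rest of the world it is the total space, the Hilbert tensor product of `L²(ℝ)` and
`E`. -/
abbrev L2 (E : Type*) [NormedAddCommGroup E] : Type _ := Lp E 2 (volume : Measure ℝ)

section TotalSpace

variable {E : Type*} [NormedAddCommGroup E] [InnerProductSpace ℂ E]

/-- The product vector `f ⊗ x`, i.e. the function `τ ↦ f τ • x`. -/
def pureTensor (f : L2 ℂ) (x : E) : L2 E :=
  ((ContinuousLinearMap.id ℂ ℂ).smulRight x).compLp f

theorem pureTensor_coe (f : L2 ℂ) (x : E) :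
    (pureTensor f x : ℝ → E) =ᵐ[volume] fun τ => (f τ : ℂ) • x := by
  filter_upwards [((ContinuousLinearMap.id ℂ ℂ).smulRight x).coeFn_compLp f] with τ h
  simpa [pureTensor] using h

/-- Together with `dense_span_pureTensor` this says that `L²(ℝ; E)` with the product vectors
`pureTensor f x` is the Hilbert space tensor product of `L²(ℝ)` and `E`. -/
theorem inner_pureTensor (f g : L2 ℂ) (x y : E) :
    inner ℂ (pureTensor f x) (pureTensor g y) = inner ℂ f g * inner ℂ x y := by
  rw [L2.inner_def, L2.inner_def, ← integral_mul_const]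
  refine integral_congr_ae ?_
  filter_upwards [pureTensor_coe f x, pureTensor_coe g y] with τ h1 h2
  rw [h1, h2, inner_smul_left, inner_smul_right]
  simp only [RCLike.inner_apply]
  ring

theorem dense_span_pureTensor :
    Dense (Submodule.span ℂ {Φ : L2 E | ∃ (f : L2 ℂ) (x : E), Φ = pureTensor f x} :
      Set (L2 E)) := by
  rw [Submodule.dense_iff_topologicalClosure_eq_top, Submodule.eq_top_iff']
  intro Φ
  refine Lp.induction (p := 2) (by norm_num)
    (motive := fun Φ => Φ ∈ (Submodule.span ℂ
      {Φ : L2 E | ∃ (f : L2 ℂ) (x : E), Φ = pureTensor f x}).topologicalClosure) ?_ ?_ ?_ Φ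
  · intro c s hs hμ
    refine Submodule.le_topologicalClosure _ (Submodule.subset_span ?_)
    refine ⟨indicatorConstLp 2 hs hμ.ne 1, c, ?_⟩
    rw [Lp.simpleFunc.coe_indicatorConst]
    apply Lp.ext
    filter_upwards [pureTensor_coe (indicatorConstLp 2 hs hμ.ne (1 : ℂ)) c,
      indicatorConstLp_coeFn (p := 2) (hs := hs) (hμs := hμ.ne) (c := c),
      indicatorConstLp_coeFn (p := 2) (hs := hs) (hμs := hμ.ne) (c := (1 : ℂ))] with τ h1 h2 h3
    rw [h1, h2, h3]
    by_cases h : τ ∈ s <;> simp [h]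
  · intro f g hf hg _ h1 h2
    exact Submodule.add_mem _ h1 h2
  · exact Submodule.isClosed_topologicalClosure _

end TotalSpace

/-! ## Hamiltonians -/

/-- The graph of `-i ħ d/dτ` on `L²(ℝ)`, on its maximal domain (the Sobolev space `H¹(ℝ)`) : the
pairs `(f, g)` with `-i ħ f' = g` in the weak sense. -/
def clockGraph (hbar : ℝ) : Submodule ℂ (L2 ℂ × L2 ℂ) where
  carrier := {p | ∀ φ : ℝ → ℂ, ContDiff ℝ ∞ φ → HasCompactSupport φ →
    ∫ τ, (Complex.I * hbar) * deriv φ τ * p.1 τ = ∫ τ, φ τ * p.2 τ}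
  zero_mem' := by
    intro φ _ _
    have h : ((0 : L2 ℂ) : ℝ → ℂ) =ᵐ[volume] 0 := Lp.coeFn_zero _ _ _
    have h1 : (fun τ => (Complex.I * hbar) * deriv φ τ * (0 : L2 ℂ) τ) =ᵐ[volume] 0 := by
      filter_upwards [h] with τ hτ
      rw [hτ]
      simp
    have h2 : (fun τ => φ τ * (0 : L2 ℂ) τ) =ᵐ[volume] 0 := by
      filter_upwards [h] with τ hτ
      rw [hτ]
      simp
    simp only [Prod.fst_zero, Prod.snd_zero]
    rw [integral_congr_ae h1, integral_congr_ae h2]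
  add_mem' := by
    intro p q hp hq φ h1 h2
    have i1 (u : ℝ → ℂ) (hu : Continuous u) (hc : HasCompactSupport u) (f : L2 ℂ) :
        Integrable (fun τ => u τ * f τ) :=
      (hu.memLp_of_hasCompactSupport (p := 2) hc).integrable_mul (Lp.memLp f)
    have hd : Continuous (deriv φ) := h1.continuous_deriv (by simp)
    have i2 (f : L2 ℂ) : Integrable (fun τ => (Complex.I * hbar) * deriv φ τ * f τ) := by
      simpa [mul_assoc] using (i1 _ hd h2.deriv f).const_mul (Complex.I * hbar)
    have e1 : (fun τ => (Complex.I * hbar) * deriv φ τ * (p + q).1 τ) =ᵐ[volume]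
        fun τ => (Complex.I * hbar) * deriv φ τ * p.1 τ
          + (Complex.I * hbar) * deriv φ τ * q.1 τ := by
      filter_upwards [Lp.coeFn_add p.1 q.1] with τ hτ
      rw [Prod.fst_add, hτ, Pi.add_apply, mul_add]
    have e2 : (fun τ => φ τ * (p + q).2 τ) =ᵐ[volume] fun τ => φ τ * p.2 τ + φ τ * q.2 τ := by
      filter_upwards [Lp.coeFn_add p.2 q.2] with τ hτ
      rw [Prod.snd_add, hτ, Pi.add_apply, mul_add]
    rw [integral_congr_ae e1, integral_congr_ae e2, integral_add (i2 _) (i2 _),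
      integral_add (i1 _ h1.continuous h2 _) (i1 _ h1.continuous h2 _), hp φ h1 h2, hq φ h1 h2]
  smul_mem' := by
    intro c p hp φ h1 h2
    have e1 : (fun τ => (Complex.I * hbar) * deriv φ τ * (c • p).1 τ) =ᵐ[volume]
        fun τ => c * ((Complex.I * hbar) * deriv φ τ * p.1 τ) := by
      filter_upwards [Lp.coeFn_smul c p.1] with τ hτ
      rw [Prod.smul_fst, hτ, Pi.smul_apply, smul_eq_mul]
      ring
    have e2 : (fun τ => φ τ * (c • p).2 τ) =ᵐ[volume] fun τ => c * (φ τ * p.2 τ) := by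
      filter_upwards [Lp.coeFn_smul c p.2] with τ hτ
      rw [Prod.smul_snd, hτ, Pi.smul_apply, smul_eq_mul]
      ring
    rw [integral_congr_ae e1, integral_congr_ae e2, integral_const_mul, integral_const_mul,
      hp φ h1 h2]

/-- The Hamiltonian `H_c = -i ħ d/dτ` of the ideal clock, on `L²(ℝ)`. -/
def clockHamiltonian (hbar : ℝ) : L2 ℂ →ₗ.[ℂ] L2 ℂ := (clockGraph hbar).toLinearPMap

section Total

variable {E : Type*} [NormedAddCommGroup E] [InnerProductSpace ℂ E]

/-- The noninteracting total Hamiltonian `H = H_c ⊗ I + I ⊗ A` on `L²(ℝ) ⊗ E`: the closure of the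
operator which is defined on the algebraic tensor product of `D(H_c)` and `D(A)` by
`f ⊗ x ↦ H_c f ⊗ x + f ⊗ A x`. -/
def totalHamiltonian (hbar : ℝ) (A : E →ₗ.[ℂ] E) : L2 E →ₗ.[ℂ] L2 E :=
  (Submodule.span ℂ {p : L2 E × L2 E |
    ∃ (f : (clockHamiltonian hbar).domain) (x : A.domain),
      p = (pureTensor (f : L2 ℂ) (x : E),
        pureTensor (clockHamiltonian hbar f) (x : E) + pureTensor (f : L2 ℂ) (A x))}
    ).topologicalClosure.toLinearPMap

end Total

/-! ## Generalized vectors -/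

section Rigged

/-- A continuous compactly supported function `ℝ → E`, as a vector of `L²(ℝ; E)`. These functions
are the test vectors of the rigged Hilbert space in which the generalized vectors live. -/
def testVector {E : Type*} [NormedAddCommGroup E] (Φ : C_c(ℝ, E)) : L2 E :=
  (Φ.continuous.memLp_of_hasCompactSupport (p := 2) Φ.hasCompactSupport).toLp Φ

/-- Generalized vectors `F` of `L²(ℝ; E)`, as functionals `Φ ↦ ⟨Φ|F⟩` on the test vectors. -/
abbrev GenVector (E : Type*) [NormedAddCommGroup E] : Type _ := C_c(ℝ, E) → ℂ

variable {E E' : Type*} [NormedAddCommGroup E] [InnerProductSpace ℂ E]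
  [NormedAddCommGroup E'] [InnerProductSpace ℂ E']

/-- The generalized vector `|τ⟩|x⟩`, with `|τ⟩` the clock reading `τ`; for a test vector `Φ`,
`⟨Φ|τ, x⟩ = ⟨Φ(τ)|x⟩`. -/
def ket (τ : ℝ) (x : E) : GenVector E := fun Φ => inner ℂ (Φ τ) x

/-- The timeless state `|Ψ⟩⟩ = ∫ |τ⟩|ψ(τ)⟩ dτ` of a history `ψ`. -/
def timelessState (ψ : ℝ → E) : GenVector E := fun Φ => ∫ τ : ℝ, ket τ (ψ τ) Φ

/-- The unitary `S` restricts to a bijection between the test vectors of the two spaces, so that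
it extends to generalized vectors. -/
def PreservesTestVectors (S : L2 E ≃ₗᵢ[ℂ] L2 E') : Prop :=
  (∀ Φ : C_c(ℝ, E), ∃ Φ' : C_c(ℝ, E'), testVector Φ' = S (testVector Φ)) ∧
  (∀ Φ' : C_c(ℝ, E'), ∃ Φ : C_c(ℝ, E), testVector Φ = S.symm (testVector Φ'))

/-- `S F = F'` for generalized vectors `F` and `F'`: the functional `F'` is
`Φ' ↦ ⟨Φ'|S F⟩ = ⟨S⁻¹ Φ'|F⟩`. -/
def MapsGen (S : L2 E ≃ₗᵢ[ℂ] L2 E') (F : GenVector E) (F' : GenVector E') : Prop :=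
  ∀ Φ' : C_c(ℝ, E'), ∃ Φ : C_c(ℝ, E), testVector Φ = S.symm (testVector Φ') ∧ F' Φ' = F Φ

/-- `S = ∫ |τ⟩⟨τ| ⊗ R(τ) dτ`, that is, `S` acts on `Φ ∈ L²(ℝ; E)` by
`(S Φ)(τ) = R(τ) Φ(τ)` for almost every `τ`. -/
def IsClockIntegral (S : L2 E ≃ₗᵢ[ℂ] L2 E') (R : ℝ → (E ≃ₗᵢ[ℂ] E')) : Prop :=
  ∀ Φ : L2 E, (S Φ : ℝ → E') =ᵐ[volume] fun τ => R τ (Φ τ)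

/-- `H' = S H S⁻¹` as unbounded operators, domains included. For `H' = H` this says that `S`
commutes with `H`. -/
def Intertwines {X X' : Type*} [NormedAddCommGroup X] [InnerProductSpace ℂ X]
    [NormedAddCommGroup X'] [InnerProductSpace ℂ X']
    (S : X ≃ₗᵢ[ℂ] X') (H : X →ₗ.[ℂ] X) (H' : X' →ₗ.[ℂ] X') : Prop :=
  ∀ x y : X, (x, y) ∈ H.graph ↔ (S x, S y) ∈ H'.graph

end Rigged

/-! ## Page-Wootters systems -/

/-- A Page-Wootters system: the ideal clock on `L²(ℝ)`, together with a rest of the world that has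
the Hilbert space `E` and the self-adjoint Hamiltonian `H_r`. -/
structure PWSystem (E : Type*) [NormedAddCommGroup E] [InnerProductSpace ℂ E]
    [CompleteSpace E] where
  restHamiltonian : E →ₗ.[ℂ] E
  selfAdjoint : IsSelfAdjoint restHamiltonian

namespace PWSystem

variable {E E' : Type*} [NormedAddCommGroup E] [InnerProductSpace ℂ E] [CompleteSpace E]
  [NormedAddCommGroup E'] [InnerProductSpace ℂ E'] [CompleteSpace E']

/-- The total Hamiltonian `H = H_c ⊗ I + I ⊗ H_r`. -/
def hamiltonian (P : PWSystem E) (hbar : ℝ) : L2 E →ₗ.[ℂ] L2 E :=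
  totalHamiltonian hbar P.restHamiltonian

/-- The evolution `exp(-i H_r t / ħ)` of the rest of the world. -/
def restEvolution (P : PWSystem E) (hbar : ℝ) : ℝ → (E ≃ₗᵢ[ℂ] E) :=
  evolution hbar P.restHamiltonian

/-- `ψ` is a history of the system: `ψ(τ') = exp(-i H_r (τ' - τ) / ħ) ψ(τ)`, and the states are
unit vectors. -/
structure IsHistory (P : PWSystem E) (hbar : ℝ) (ψ : ℝ → E) : Prop where
  evolves : ∀ τ τ' : ℝ, ψ τ' = P.restEvolution hbar (τ' - τ) (ψ τ)
  unit : ∀ τ : ℝ, ‖ψ τ‖ = 1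

/-- The unitary `S` is an equivalence of the bare Page-Wootters system `P` with history `ψ` and the
bare Page-Wootters system `P'` with history `ψ'`: it transforms the total Hamiltonians into each
other, maps every temporal state `|τ⟩|ψ(τ)⟩` to `|τ⟩|ψ'(τ)⟩`, and maps the timeless state of `ψ` to
that of `ψ'`. -/
structure IsBareEquivalence (hbar : ℝ) (P : PWSystem E) (ψ : ℝ → E) (P' : PWSystem E')
    (ψ' : ℝ → E') (S : L2 E ≃ₗᵢ[ℂ] L2 E') : Prop where
  law : Intertwines S (P.hamiltonian hbar) (P'.hamiltonian hbar)
  test : PreservesTestVectors S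
  temporal : ∀ τ : ℝ, MapsGen S (ket τ (ψ τ)) (ket τ (ψ' τ))
  timeless : MapsGen S (timelessState ψ) (timelessState ψ')

/-- Bare Page-Wootters equivalence. -/
def BareEquivalent (hbar : ℝ) (P : PWSystem E) (ψ : ℝ → E) (P' : PWSystem E')
    (ψ' : ℝ → E') : Prop :=
  ∃ S : L2 E ≃ₗᵢ[ℂ] L2 E', IsBareEquivalence hbar P ψ P' ψ' S

/-- The operators `S_τ = exp(-i H_r τ / ħ) S₀ exp(i H_r τ / ħ)`. -/
def conjEvolution (P : PWSystem E) (hbar : ℝ) (S₀ : E ≃ₗᵢ[ℂ] E) (τ : ℝ) : E ≃ₗᵢ[ℂ] E :=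
  ((P.restEvolution hbar (-τ)).trans S₀).trans (P.restEvolution hbar τ)

end PWSystem

end PageWootters

end

/-! Let `U` be the evolution of the rest. Every temporal fibre is moved by the conjugated unitary
`S_τ = U_τ S₀ U_{-τ}`, which carries `ψ τ` to `ψ' τ` as soon as `S₀` carries `ψ 0` to `ψ' 0`. The
total evolution is `(V_t Φ)(τ) = U_t Φ(τ - t)`, and `S_τ U_t = U_t S_{τ-t}` says exactly that the
fibrewise operator `S` commutes with every `V_t`. A unitary commuting with a group preserves the
graph of its generator, so everything reduces to identifying the total Hamiltonian with the
generator of `V`.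

The analytic core is a core theorem, `IsSymmetricGraph.le_topologicalClosure_span`: a set of
generator pairs whose first components are invariant and span a dense subspace already determines,
after closure, every symmetric extension. In `IsEvolutionGroup.graph_totalHamiltonian` it is applied
to product vectors, where the clock part is the generator of translations by
`clockGraph_le_generatorGraph`. It also completes the proof of Stone's theorem
(`exists_isEvolutionGroup`), where the group is built by continuous functional calculus of the
Cayley transform and must be shown to have no generator other than the given operator.

A suitable `S₀` exists because a phase followed by a reflection moves any vector to any other of the
same norm. The statements on generalized vectors follow because `S` acts pointwise on test functions
and each `S_τ` is unitary. -/

noncomputable section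

namespace PageWootters

/-! ### Symmetric graphs and the range of `A ± i` -/

section SymmetricGraph

variable {X : Type*} [NormedAddCommGroup X] [InnerProductSpace ℂ X]

/-- The graph of a symmetric (possibly multivalued) operator. -/
def IsSymmetricGraph (G : Submodule ℂ (X × X)) : Prop :=
  ∀ p ∈ G, ∀ q ∈ G, inner ℂ p.2 q.1 = inner ℂ p.1 q.2

theorem IsSymmetricGraph.mono {G G' : Submodule ℂ (X × X)} (h : IsSymmetricGraph G')
    (hle : G ≤ G') : IsSymmetricGraph G :=
  fun p hp q hq => h p (hle hp) q (hle hq)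

theorem IsSymmetricGraph.topologicalClosure {G : Submodule ℂ (X × X)} (h : IsSymmetricGraph G) :
    IsSymmetricGraph G.topologicalClosure := by
  have h1 : ∀ q ∈ G, ∀ p ∈ G.topologicalClosure, inner ℂ p.2 q.1 = inner ℂ p.1 q.2 := by
    intro q hq p hp
    exact closure_minimal (t := {p : X × X | inner ℂ p.2 q.1 = inner ℂ p.1 q.2})
      (fun p hp => h p hp q hq) (isClosed_eq (by fun_prop) (by fun_prop)) hp
  intro p hp q hq
  exact closure_minimal (t := {q : X × X | inner ℂ p.2 q.1 = inner ℂ p.1 q.2})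
      (fun q hq => h1 q hq p hp) (isClosed_eq (by fun_prop) (by fun_prop)) hq

/-- Symmetry makes `⟨p.2, p.1⟩` real, so with `c` purely imaginary the cross term has zero real
part. -/
theorem IsSymmetricGraph.norm_sq {G : Submodule ℂ (X × X)} (h : IsSymmetricGraph G) {c : ℂ}
    (hre : c.re = 0) (hc : ‖c‖ = 1) {p : X × X} (hp : p ∈ G) :
    ‖p.2 + c • p.1‖ ^ 2 = ‖p.2‖ ^ 2 + ‖p.1‖ ^ 2 := by
  have h1 : (inner ℂ p.2 p.1).im = 0 := by
    have := h p hp p hp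
    rw [← inner_conj_symm p.1 p.2] at this
    exact Complex.conj_eq_iff_im.1 this.symm
  rw [@norm_add_sq ℂ, inner_smul_right, norm_smul, hc]
  simp [hre, h1]

theorem IsSymmetricGraph.eq_of_eq {G : Submodule ℂ (X × X)} (h : IsSymmetricGraph G) {c : ℂ}
    (hre : c.re = 0) (hc : ‖c‖ = 1) {p q : X × X} (hp : p ∈ G) (hq : q ∈ G)
    (hpq : p.2 + c • p.1 = q.2 + c • q.1) : p = q := by
  have h1 := h.norm_sq hre hc (G.sub_mem hp hq)
  have h2 : (p - q).2 + c • (p - q).1 = 0 := by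
    rw [Prod.fst_sub, Prod.snd_sub, smul_sub, sub_add_sub_comm, hpq, sub_self]
  rw [h2, norm_zero] at h1
  have h3 : ‖(p - q).1‖ = 0 := by nlinarith [sq_nonneg ‖(p - q).1‖, sq_nonneg ‖(p - q).2‖]
  have h4 : ‖(p - q).2‖ = 0 := by nlinarith [sq_nonneg ‖(p - q).1‖, sq_nonneg ‖(p - q).2‖]
  exact sub_eq_zero.1 (Prod.ext (norm_eq_zero.1 h3) (norm_eq_zero.1 h4))

/-- The norm identity bounds `p` by `p.2 + c • p.1`; on a complete graph this makes the range
closed, and `horth` says that its orthogonal complement is trivial. -/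
theorem IsSymmetricGraph.exists_add_smul_eq [CompleteSpace X] {G : Submodule ℂ (X × X)}
    (h : IsSymmetricGraph G) (hcl : IsClosed (G : Set (X × X))) {c : ℂ}
    (hre : c.re = 0) (hc : ‖c‖ = 1)
    (horth : ∀ z, (∀ p ∈ G, inner ℂ (p.2 + c • p.1) z = 0) → z = 0) (z : X) :
    ∃ p ∈ G, p.2 + c • p.1 = z := by
  let L : G →L[ℂ] X :=
    (ContinuousLinearMap.snd ℂ X X + c • ContinuousLinearMap.fst ℂ X X).comp G.subtypeL
  have hL : ∀ p : G, L p = (p : X × X).2 + c • (p : X × X).1 := fun p => rfl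
  have : CompleteSpace G := hcl.completeSpace_coe
  have hanti : AntilipschitzWith 1 L := by
    refine AddMonoidHomClass.antilipschitz_of_bound L fun p => ?_
    have h1 := h.norm_sq hre hc p.2
    simp only [NNReal.coe_one, one_mul, hL]
    rw [Submodule.coe_norm, Prod.norm_def]
    refine max_le ?_ ?_
    · exact abs_le_of_sq_le_sq' (by nlinarith [sq_nonneg ‖(p : X × X).2‖]) (norm_nonneg _) |>.2
    · exact abs_le_of_sq_le_sq' (by nlinarith [sq_nonneg ‖(p : X × X).1‖]) (norm_nonneg _) |>.2
  have hran : IsClosed (L.toLinearMap.range : Set X) := by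
    rw [LinearMap.coe_range]
    exact hanti.isClosed_range L.uniformContinuous
  have htop : L.toLinearMap.range = ⊤ := by
    rw [← hran.submodule_topologicalClosure_eq, Submodule.topologicalClosure_eq_top_iff,
      Submodule.eq_bot_iff]
    intro z hz
    refine horth z fun p hp => ?_
    exact (Submodule.mem_orthogonal _ _).1 hz _ ⟨⟨p, hp⟩, rfl⟩
  obtain ⟨p, hp⟩ : z ∈ L.toLinearMap.range := htop ▸ Submodule.mem_top
  exact ⟨p, p.2, hp⟩

end SymmetricGraph

/-! ### Generators of isometry groups and the core theorem -/

section Generator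

variable {X : Type*} [NormedAddCommGroup X] [InnerProductSpace ℂ X]

/-- A one-parameter group of isometries. -/
structure IsIsometryGroup (V : ℝ → (X →ₗᵢ[ℂ] X)) : Prop where
  map_zero : ∀ x, V 0 x = x
  map_add : ∀ (s t : ℝ) (x : X), V (s + t) x = V s (V t x)

/-- The graph of the infinitesimal generator of `V`, normalized as a Hamiltonian. -/
def generatorGraph (hbar : ℝ) (V : ℝ → (X →ₗᵢ[ℂ] X)) :
    Submodule ℂ (X × X) where
  carrier := {p | HasDerivAt (fun t : ℝ => V t p.1) ((-(Complex.I / (hbar : ℂ))) • p.2) 0}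
  zero_mem' := by simpa using hasDerivAt_const (0 : ℝ) (0 : X)
  add_mem' := by
    intro p q hp hq
    change HasDerivAt (fun t : ℝ => V t (p.1 + q.1)) ((-(Complex.I / (hbar : ℂ))) • (p.2 + q.2)) 0
    simp only [map_add, smul_add]
    exact HasDerivAt.add hp hq
  smul_mem' := by
    intro c p hp
    have := HasDerivAt.const_smul c hp
    change HasDerivAt (fun t : ℝ => V t (c • p.1)) ((-(Complex.I / (hbar : ℂ))) • (c • p.2)) 0
    simp only [map_smul]
    rw [← smul_comm c]
    exact this

variable {hbar : ℝ} {V : ℝ → (X →ₗᵢ[ℂ] X)}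

theorem mem_generatorGraph {p : X × X} : p ∈ generatorGraph hbar V ↔
    HasDerivAt (fun t : ℝ => V t p.1) ((-(Complex.I / (hbar : ℂ))) • p.2) 0 := Iff.rfl

/-- Differentiate the constant function `⟨V_t x, V_t y⟩` at `0`. -/
theorem isSymmetricGraph_generatorGraph (hV : IsIsometryGroup V) (hpos : 0 < hbar) :
    IsSymmetricGraph (generatorGraph hbar V) := by
  intro p hp q hq
  have h1 := HasDerivAt.inner ℂ hp hq
  have h2 : (fun t : ℝ => inner ℂ (V t p.1) (V t q.1)) = fun _ => inner ℂ p.1 q.1 := by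
    funext t
    exact (V t).inner_map_map _ _
  rw [h2] at h1
  have h3 := h1.unique (hasDerivAt_const _ _)
  simp only [hV.map_zero, inner_smul_left, inner_smul_right] at h3
  have hne : (hbar : ℂ) ≠ 0 := by exact_mod_cast hpos.ne'
  simp only [map_neg, map_div₀, Complex.conj_I, Complex.conj_ofReal] at h3
  field_simp at h3
  have h4 : Complex.I * (inner ℂ p.2 q.1 - inner ℂ p.1 q.2) = 0 := by linear_combination h3
  simpa [sub_eq_zero] using h4

theorem hasDerivAt_of_mem_generatorGraph (hV : IsIsometryGroup V) {p : X × X}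
    (hp : p ∈ generatorGraph hbar V) (t : ℝ) :
    HasDerivAt (fun s : ℝ => V s p.1) ((-(Complex.I / (hbar : ℂ))) • V t p.2) t := by
  have h1 : HasDerivAt (fun s : ℝ => V (s - t) p.1) ((-(Complex.I / (hbar : ℂ))) • p.2) t := by
    have h0 : HasDerivAt (fun t : ℝ => V t p.1) ((-(Complex.I / (hbar : ℂ))) • p.2) (t - t) := by
      rw [sub_self]; exact hp
    exact HasDerivAt.comp_sub_const t t h0
  have h2 := ((V t).toContinuousLinearMap.restrictScalars ℝ).hasFDerivAt.comp_hasDerivAt t h1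
  have h3 : (fun s : ℝ => V s p.1) = fun s : ℝ => V t (V (s - t) p.1) := by
    funext s
    rw [← hV.map_add, add_sub_cancel]
  rw [h3]
  simpa [Function.comp_def] using h2

theorem map_mem_generatorGraph (hV : IsIsometryGroup V) {p : X × X}
    (hp : p ∈ generatorGraph hbar V) (t : ℝ) :
    (V t p.1, V t p.2) ∈ generatorGraph hbar V := by
  have h := hasDerivAt_of_mem_generatorGraph hV hp t
  have h1 : HasDerivAt (fun s : ℝ => V s p.1) ((-(Complex.I / (hbar : ℂ))) • V t p.2) (0 + t) := by
    rwa [zero_add]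
  rw [mem_generatorGraph]
  have h2 := HasDerivAt.comp_add_const 0 t h1
  simpa only [hV.map_add] using h2

/-- A dense set of vectors which is invariant under a one-parameter group of isometries is a core
of the generator, and every symmetric operator which extends the generator on this set is contained
in the generator. -/
theorem IsSymmetricGraph.le_topologicalClosure_span [CompleteSpace X] (hpos : 0 < hbar)
    (hV : IsIsometryGroup V)
    {T : Set (X × X)} (hT : T ⊆ generatorGraph hbar V)
    (hinv : ∀ p ∈ T, ∀ t, ∃ y, (V t p.1, y) ∈ T)
    (hdense : (Submodule.span ℂ (Prod.fst '' T)).topologicalClosure = ⊤)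
    {G : Submodule ℂ (X × X)} (hG : IsSymmetricGraph G) (hTG : T ⊆ G) :
    G ≤ (Submodule.span ℂ T).topologicalClosure := by
  have hle : Submodule.span ℂ T ≤ G := Submodule.span_le.2 hTG
  have hre : Complex.I.re = 0 := Complex.I_re
  have hK : (Submodule.span ℂ T).topologicalClosure ≤ G.topologicalClosure :=
    Submodule.topologicalClosure_mono hle
  have hsymm := hG.topologicalClosure
  have hne : (hbar : ℂ) ≠ 0 := by exact_mod_cast hpos.ne'
  have horth : ∀ z, (∀ p ∈ (Submodule.span ℂ T).topologicalClosure,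
      inner ℂ (p.2 + Complex.I • p.1) z = 0) → z = 0 := by
    intro z hz
    suffices h : ∀ p ∈ T, inner ℂ p.1 z = 0 by
      have h1 : z ∈ (Submodule.span ℂ (Prod.fst '' T))ᗮ := by
        rw [Submodule.mem_orthogonal]
        intro u hu
        induction hu using Submodule.span_induction with
        | mem u hu =>
          obtain ⟨p, hp, rfl⟩ := hu
          exact h p hp
        | zero => exact inner_zero_left _
        | add u v _ _ hu hv => rw [inner_add_left, hu, hv, add_zero]
        | smul c u _ hu => rw [inner_smul_left, hu, mul_zero]
      rw [Submodule.topologicalClosure_eq_top_iff.1 hdense] at h1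
      exact (Submodule.mem_bot ℂ).1 h1
    intro p hp
    -- For `z` orthogonal to the range of `A + i`, the function `g t = ⟨z, V_t p.1⟩` solves `g' = -g
    -- / ħ`, because the orbit stays in the domain. Hence `g t = exp(-t/ħ) g 0`, while `g` is
    -- bounded by `‖z‖ ‖p.1‖`; letting `t → -∞` forces `g 0 = 0`.
    have hderiv : ∀ t, HasDerivAt (fun t : ℝ => inner ℂ z (V t p.1))
        (-(1 / hbar : ℂ) * inner ℂ z (V t p.1)) t := by
      intro t
      obtain ⟨y, hy⟩ := hinv p hp t
      have hp1 := hasDerivAt_of_mem_generatorGraph hV (hT hp) t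
      -- Invariance only provides some `y` over `V t p.1`; uniqueness of the derivative identifies
      -- it with `V t p.2` up to the nominal factor `-i/ħ`.
      have hy1 := hT hy
      have hy2 := map_mem_generatorGraph hV (hT hp) t
      have hy3 : (-(Complex.I / (hbar : ℂ))) • y = (-(Complex.I / (hbar : ℂ))) • V t p.2 :=
        HasDerivAt.unique hy1 hy2
      have hz1 := hz _ (Submodule.le_topologicalClosure _ (Submodule.subset_span hy))
      rw [← inner_conj_symm, map_eq_zero] at hz1
      rw [inner_add_right, inner_smul_right] at hz1
      have h2 := HasDerivAt.inner ℂ (hasDerivAt_const t z) hp1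
      rw [← hy3] at h2
      convert! h2 using 1
      simp only [inner_zero_left, add_zero, inner_smul_right]
      have hz2 : inner ℂ z y = -(Complex.I * inner ℂ z (V t p.1)) := by linear_combination hz1
      rw [hz2]
      field_simp
      ring_nf
      simp
    have hconst : ∀ t : ℝ, Complex.exp (t / hbar) * inner ℂ z (V t p.1) = inner ℂ z p.1 := by
      have hd : ∀ t : ℝ, HasDerivAt
          (fun t : ℝ => Complex.exp (t / hbar) * inner ℂ z (V t p.1)) 0 t := by
        intro t
        have h1 : HasDerivAt (fun t : ℝ => Complex.exp (t / hbar))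
            (Complex.exp (t / hbar) * (1 / hbar)) t :=
          ((Complex.ofRealCLM.hasDerivAt (x := t)).div_const (hbar : ℂ)).cexp
        convert! h1.mul (hderiv t) using 1
        ring
      intro t
      have := is_const_of_deriv_eq_zero (fun t => (hd t).differentiableAt)
        (fun t => (hd t).deriv) t 0
      simpa [hV.map_zero] using this
    have hbound : ∀ n : ℕ, ‖inner ℂ z p.1‖ ≤ Real.exp (-n) * (‖z‖ * ‖p.1‖) := by
      intro n
      rw [← hconst (-(n * hbar)), norm_mul, Complex.norm_exp]
      have h1 : (((-(n * hbar) : ℝ) : ℂ) / hbar).re = -n := by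
        push_cast
        field_simp
        simp
      rw [h1]
      refine mul_le_mul_of_nonneg_left ?_ (Real.exp_nonneg _)
      simpa using norm_inner_le_norm z (V (-(n * hbar)) p.1)
    have hlim : Tendsto (fun n : ℕ => Real.exp (-n) * (‖z‖ * ‖p.1‖)) atTop (𝓝 0) := by
      simpa using (Real.tendsto_exp_neg_atTop_nhds_zero.comp
        tendsto_natCast_atTop_atTop).mul_const (‖z‖ * ‖p.1‖)
    have h0 : ‖inner ℂ z p.1‖ ≤ 0 := ge_of_tendsto' hlim hbound
    rw [← inner_conj_symm, map_eq_zero]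
    exact norm_le_zero_iff.1 h0
  -- `A + i` is onto already on the closed span of `T`, and injective on the closure of the larger
  -- graph `G`; so `p` coincides with the preimage found in the smaller one.
  intro p hp
  obtain ⟨q, hq, hqp⟩ := (hsymm.mono hK).exists_add_smul_eq
    (Submodule.isClosed_topologicalClosure _) hre Complex.norm_I horth (p.2 + Complex.I • p.1)
  have := hsymm.eq_of_eq hre Complex.norm_I (hK hq) (Submodule.le_topologicalClosure _ hp) hqp
  exact this ▸ hq

/-- Since every `V t` is isometric, convergence of the second components makes the derivatives along
the orbits converge uniformly in `t`, so differentiation passes to the limit. -/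
theorem isClosed_generatorGraph (hV : IsIsometryGroup V) :
    IsClosed (generatorGraph hbar V : Set (X × X)) := by
  refine isClosed_of_closure_subset fun p hp => ?_
  obtain ⟨q, hq, hlim⟩ := mem_closure_iff_seq_limit.1 hp
  have hlim1 : Tendsto (fun n => (q n).1) atTop (𝓝 p.1) := (continuous_fst.tendsto p).comp hlim
  have hlim2 : Tendsto (fun n => (q n).2) atTop (𝓝 p.2) := (continuous_snd.tendsto p).comp hlim
  have h1 : TendstoUniformly (fun n t => V t ((-(Complex.I / (hbar : ℂ))) • (q n).2))
      (fun t => V t ((-(Complex.I / (hbar : ℂ))) • p.2)) atTop := by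
    rw [Metric.tendstoUniformly_iff]
    intro ε hε
    filter_upwards [Metric.tendsto_nhds.1 (hlim2.const_smul (-(Complex.I / (hbar : ℂ)))) ε hε]
      with n hn t
    rwa [(V t).dist_map, dist_comm]
  have h2 := hasDerivAt_of_tendstoUniformly (f := fun n t => V t (q n).1) h1
    (Eventually.of_forall fun n t => by
      simpa only [map_smul] using hasDerivAt_of_mem_generatorGraph hV (hq n) t)
    (g := fun t => V t p.1) (fun t => ((V t).continuous.tendsto _).comp hlim1) 0
  rw [hV.map_zero] at h2
  exact h2

theorem topologicalClosure_span_eq_generatorGraph [CompleteSpace X] (hpos : 0 < hbar)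
    (hV : IsIsometryGroup V) {T : Set (X × X)} (hT : T ⊆ generatorGraph hbar V)
    (hinv : ∀ p ∈ T, ∀ t, ∃ y, (V t p.1, y) ∈ T)
    (hdense : (Submodule.span ℂ (Prod.fst '' T)).topologicalClosure = ⊤) :
    (Submodule.span ℂ T).topologicalClosure = generatorGraph hbar V :=
  le_antisymm (Submodule.topologicalClosure_minimal _ (Submodule.span_le.2 hT)
      (isClosed_generatorGraph hV))
    ((isSymmetricGraph_generatorGraph hV hpos).le_topologicalClosure_span hpos hV hT hinv hdense hT)

end Generator

/-! ### The Cayley transform of a self-adjoint operator -/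

section Cayley

variable {X : Type*} [NormedAddCommGroup X] [InnerProductSpace ℂ X] [CompleteSpace X]

theorem _root_.IsSelfAdjoint.mem_graph_iff_inner {A : X →ₗ.[ℂ] X} (hA : IsSelfAdjoint A)
    (q : X × X) : q ∈ A.graph ↔ ∀ p ∈ A.graph, inner ℂ p.2 q.1 = inner ℂ p.1 q.2 := by
  conv_lhs => rw [← LinearPMap.isSelfAdjoint_def.1 hA,
    LinearPMap.adjoint_graph_eq_graph_adjoint hA.dense_domain, Submodule.mem_adjoint_iff]
  simp only [sub_eq_zero, Prod.forall]

theorem _root_.IsSelfAdjoint.isSymmetricGraph {A : X →ₗ.[ℂ] X} (hA : IsSelfAdjoint A) :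
    IsSymmetricGraph A.graph :=
  fun p hp q hq => (hA.mem_graph_iff_inner q).1 hq p hp

/-- A vector `z` orthogonal to the range of `A + c` gives `(z, c • z)` in the graph of the adjoint,
which is `A`. Then `2c • z` lies in that range, so `z` is orthogonal to a nonzero multiple of
itself. -/
theorem _root_.IsSelfAdjoint.exists_mem_graph_add_smul_eq {A : X →ₗ.[ℂ] X}
    (hA : IsSelfAdjoint A) {c : ℂ} (hre : c.re = 0) (hc : ‖c‖ = 1) (z : X) :
    ∃ p ∈ A.graph, p.2 + c • p.1 = z := by
  refine hA.isSymmetricGraph.exists_add_smul_eq hA.isClosed hre hc (fun z hz => ?_) z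
  have hconj : (starRingEnd ℂ) c = -c := by
    apply Complex.ext <;> simp [hre]
  have h1 : (z, c • z) ∈ A.graph := by
    rw [hA.mem_graph_iff_inner]
    intro p hp
    have := hz p hp
    rw [inner_add_left, inner_smul_left, hconj] at this
    simp only [inner_smul_right]
    linear_combination this
  have h2 := hz _ h1
  have hne : c ≠ 0 := by
    rw [← norm_pos_iff, hc]; exact one_pos
  rw [← two_smul ℂ (c • z), inner_smul_left, inner_smul_left] at h2
  simpa [hne] using h2

/-- The Cayley transform of a self-adjoint operator. -/
theorem _root_.IsSelfAdjoint.exists_cayley {A : X →ₗ.[ℂ] X} (hA : IsSelfAdjoint A) :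
    ∃ C : X ≃ₗᵢ[ℂ] X, ∀ p : X × X,
      p ∈ A.graph ↔ ∃ u, p = (u - C u, Complex.I • (u + C u)) := by
  have key : ∀ c : ℂ, c.re = 0 → ‖c‖ = 1 →
      ∃ e : A.graph ≃ₗ[ℂ] X, ∀ p, e p = (p : X × X).2 + c • (p : X × X).1 := by
    intro c hre hc
    let L : A.graph →ₗ[ℂ] X :=
      (LinearMap.snd ℂ X X + c • LinearMap.fst ℂ X X).comp A.graph.subtype
    have hL : ∀ p : A.graph, L p = (p : X × X).2 + c • (p : X × X).1 := fun p => rfl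
    refine ⟨LinearEquiv.ofBijective L ⟨fun p q hpq => ?_, fun z => ?_⟩, hL⟩
    · exact Subtype.ext (hA.isSymmetricGraph.eq_of_eq hre hc p.2 q.2 hpq)
    · obtain ⟨p, hp, h⟩ := hA.exists_mem_graph_add_smul_eq hre hc z
      exact ⟨⟨p, hp⟩, h⟩
  obtain ⟨e, he⟩ := key Complex.I Complex.I_re Complex.norm_I
  obtain ⟨e', he'⟩ := key (-Complex.I) (by simp) (by simp)
  let C : X ≃ₗᵢ[ℂ] X :=
    { e.symm.trans e' with
      norm_map' := by
        intro u
        obtain ⟨p, rfl⟩ := e.surjective u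
        have h1 := hA.isSymmetricGraph.norm_sq Complex.I_re Complex.norm_I p.2
        have h2 := hA.isSymmetricGraph.norm_sq (c := -Complex.I) (by simp) (by simp) p.2
        simp only [LinearEquiv.trans_apply, LinearEquiv.symm_apply_apply]
        rw [he, he']
        exact (sq_eq_sq₀ (norm_nonneg _) (norm_nonneg _)).1 (h2.trans h1.symm) }
  have hC : ∀ p, C (e p) = e' p := by
    intro p
    change e' (e.symm (e p)) = e' p
    rw [e.symm_apply_apply]
  -- Here `C = (A - i)(A + i)⁻¹`, and `u = (2i)⁻¹ (A + i) x` solves `u - C u = x`, `i (u + C u) = A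
  -- x`.
  refine ⟨C, fun p => ⟨fun hp => ⟨(2 * Complex.I)⁻¹ • e ⟨p, hp⟩, ?_⟩, ?_⟩⟩
  · have h2 : (2 * Complex.I) ≠ 0 := by simp
    rw [map_smul, hC, he, he']
    refine Prod.ext ?_ ?_
    · simp only
      rw [← smul_sub, eq_inv_smul_iff₀ h2]
      module
    · simp only
      rw [← smul_add, smul_comm, eq_inv_smul_iff₀ h2]
      module
  · rintro ⟨u, rfl⟩
    obtain ⟨p, hp⟩ := e.surjective ((2 * Complex.I) • u)
    have hu : u = (2 * Complex.I)⁻¹ • e p := by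
      rw [hp, inv_smul_smul₀ (by simp)]
    have h2 : (2 * Complex.I) ≠ 0 := by simp
    suffices h : (u - C u, Complex.I • (u + C u)) = (p : X × X) by
      rw [h]
      exact p.2
    rw [hu, map_smul, hC, he, he']
    refine Prod.ext ?_ ?_
    · simp only
      rw [← smul_sub, inv_smul_eq_iff₀ h2]
      module
    · simp only
      rw [← smul_add, smul_comm, inv_smul_eq_iff₀ h2]
      module

end Cayley

/-! ### Extending a unitary group from a dense range -/

section Extension

variable {X : Type*} [NormedAddCommGroup X] [InnerProductSpace ℂ X] [CompleteSpace X]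

/-- A one-parameter unitary group is determined by its products with an operator of dense range. -/
theorem exists_unitaryGroup_of_mul {D : X →L[ℂ] X} (hD : DenseRange D) {Q : ℝ → (X →L[ℂ] X)}
    (hnorm : ∀ t x, ‖Q t x‖ = ‖D x‖) (hzero : Q 0 = D) (hcomm : ∀ t, Q t * D = D * Q t)
    (hadd : ∀ s t, Q s * Q t = Q (s + t) * D) :
    ∃ U : ℝ → (X ≃ₗᵢ[ℂ] X), (∀ t x, U t (D x) = Q t x) ∧ (∀ x, U 0 x = x) ∧
      ∀ (s t : ℝ) (x : X), U (s + t) x = U s (U t x) := by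
  let W : ℝ → (X →L[ℂ] X) := fun t => (Q t).toLinearMap.extendOfNorm D.toLinearMap
  have hW : ∀ t x, W t (D x) = Q t x := fun t x =>
    LinearMap.extendOfNorm_eq (f := (Q t).toLinearMap) (e := D.toLinearMap) hD
      ⟨1, fun x => by simp [hnorm]⟩ x
  have hWnorm : ∀ t x, ‖W t x‖ = ‖x‖ := by
    intro t x
    refine hD.induction_on x (isClosed_eq (by fun_prop) (by fun_prop)) fun x => ?_
    rw [hW, hnorm]
  have hW0 : ∀ x, W 0 x = x := by
    intro x
    refine hD.induction_on x (isClosed_eq (by fun_prop) (by fun_prop)) fun x => ?_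
    rw [hW, hzero]
  have hWadd : ∀ s t x, W (s + t) x = W s (W t x) := by
    intro s t x
    refine hD.induction_on x (isClosed_eq (by fun_prop) (by fun_prop)) fun x => ?_
    -- The product law `hadd` carries an extra factor `D`, so density is used a second time and the
    -- identity is checked on `D (D x)`.
    refine hD.induction_on x (isClosed_eq (by fun_prop) (by fun_prop)) fun x => ?_
    have h1 : Q t (D x) = D (Q t x) := congr($(hcomm t) x)
    have h2 : Q s (Q t x) = Q (s + t) (D x) := congr($(hadd s t) x)
    rw [hW, hW, h1, hW, h2]
  refine ⟨fun t =>
    { (W t).toLinearMap with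
      invFun := W (-t)
      left_inv := fun x => ?_
      right_inv := fun x => ?_
      norm_map' := hWnorm t }, hW, hW0, hWadd⟩
  · change W (-t) (W t x) = x
    rw [← hWadd, neg_add_cancel, hW0]
  · change W t (W (-t) x) = x
    rw [← hWadd, add_neg_cancel, hW0]

end Extension

/-! ### The exponential as a function on the unit circle -/

section CayleyExp

/-- The function `exp(-i t λ / ħ) (1 - z)` of the Cayley transform `z = (λ - i) / (λ + i)`. -/
def cayleyExp (hbar t : ℝ) (z : ℂ) : ℂ :=
  Complex.exp ((t / hbar : ℝ) * ((1 + z) / (1 - z))) * (1 - z)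

theorem re_cayley_eq_zero {z : ℂ} (hz : ‖z‖ = 1) : ((1 + z) / (1 - z)).re = 0 := by
  -- At `z = 1` division by zero returns `0`, so the claim still holds there.
  by_cases h1 : z = 1
  · simp [h1]
  have h0 : z ≠ 0 := by
    rintro rfl
    simp at hz
  have hconj : (starRingEnd ℂ) z = z⁻¹ := (Complex.inv_eq_conj hz).symm
  have h3 : (1 - z) ≠ 0 := sub_ne_zero.2 (Ne.symm h1)
  have h3' : (z - 1) ≠ 0 := sub_ne_zero.2 h1
  have h2 : (starRingEnd ℂ) ((1 + z) / (1 - z)) = -((1 + z) / (1 - z)) := by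
    rw [map_div₀, map_add, map_sub, map_one, hconj]
    have h4 : 1 - z⁻¹ = (z - 1) / z := by field_simp
    rw [h4]
    field_simp
    ring
  have := congrArg Complex.re h2
  rw [Complex.conj_re, Complex.neg_re] at this
  linarith

variable {hbar : ℝ}

theorem norm_exp_cayley (a : ℝ) {z : ℂ} (hz : ‖z‖ = 1) :
    ‖Complex.exp (a * ((1 + z) / (1 - z)))‖ = 1 := by
  rw [Complex.norm_exp, Complex.re_ofReal_mul, re_cayley_eq_zero hz, mul_zero, Real.exp_zero]

theorem norm_cayleyExp (t : ℝ) {z : ℂ} (hz : ‖z‖ = 1) : ‖cayleyExp hbar t z‖ = ‖1 - z‖ := by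
  rw [cayleyExp, norm_mul, norm_exp_cayley _ hz, one_mul]

theorem continuousOn_cayleyExp (t : ℝ) :
    ContinuousOn (cayleyExp hbar t) (Metric.sphere 0 1) := by
  intro z hz
  -- The point `z = 1` corresponds to `λ = ∞`, where the exponential oscillates; having modulus one
  -- on the circle, it is squeezed to `0` by the factor `1 - z`.
  by_cases h1 : z = 1
  · subst h1
    have h2 : Tendsto (fun z : ℂ => ‖1 - z‖) (𝓝[Metric.sphere 0 1] 1) (𝓝 0) := by
      have : Continuous fun z : ℂ => ‖1 - z‖ := by fun_prop
      simpa using (this.tendsto 1).mono_left nhdsWithin_le_nhds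
    rw [ContinuousWithinAt]
    have h3 : cayleyExp hbar t 1 = 0 := by simp [cayleyExp]
    rw [h3]
    refine squeeze_zero_norm' ?_ h2
    filter_upwards [self_mem_nhdsWithin] with z hz
    exact (norm_cayleyExp t (by simpa using hz)).le
  · have h3 : (1 - z) ≠ 0 := sub_ne_zero.2 (Ne.symm h1)
    refine ContinuousAt.continuousWithinAt ?_
    unfold cayleyExp
    fun_prop (disch := assumption)

theorem cayleyExp_zero : cayleyExp hbar 0 = fun z => 1 - z := by
  funext z
  simp [cayleyExp]

theorem cayleyExp_mul (s t : ℝ) (z : ℂ) :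
    cayleyExp hbar s z * cayleyExp hbar t z = cayleyExp hbar (s + t) z * (1 - z) := by
  have : ((s + t) / hbar : ℝ) * ((1 + z) / (1 - z))
      = (s / hbar : ℝ) * ((1 + z) / (1 - z)) + (t / hbar : ℝ) * ((1 + z) / (1 - z)) := by
    rw [add_div]; push_cast; ring
  rw [cayleyExp, cayleyExp, cayleyExp, this, Complex.exp_add]
  ring

/-- For `‖w‖ ≤ 1` this is the Taylor estimate; for `‖w‖ > 1` use `‖exp w‖ = 1` and `2 + ‖w‖ ≤
3‖w‖²`. -/
theorem norm_exp_sub_one_sub_le {w : ℂ} (hw : w.re = 0) :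
    ‖Complex.exp w - 1 - w‖ ≤ 3 * ‖w‖ ^ 2 := by
  by_cases h : ‖w‖ ≤ 1
  · have := Complex.norm_exp_sub_one_sub_id_le h
    nlinarith [sq_nonneg ‖w‖]
  · have h1 : ‖Complex.exp w‖ = 1 := by rw [Complex.norm_exp, hw, Real.exp_zero]
    have h2 : ‖Complex.exp w - 1 - w‖ ≤ 1 + 1 + ‖w‖ := by
      refine (norm_sub_le _ _).trans (add_le_add_left ((norm_sub_le _ _).trans ?_) _)
      rw [h1, norm_one]
    nlinarith

/-- The second factor `1 - z` makes the Taylor remainder uniform on the circle: `w (1 - z) = (t/ħ)(1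
+ z)` has no pole, and `‖1 + z‖ ≤ 2` gives `12 = 3 · 2²`. -/
theorem norm_cayleyExp_sub_le (t : ℝ) {z : ℂ} (hz : ‖z‖ = 1) :
    ‖(cayleyExp hbar t z - (1 - z)) * (1 - z) - (t / hbar : ℝ) * ((1 + z) * (1 - z))‖
      ≤ 12 * (t / hbar) ^ 2 := by
  by_cases h1 : z = 1
  · simp only [h1, sub_self, mul_zero, norm_zero]; positivity
  have h3 : (1 - z) ≠ 0 := sub_ne_zero.2 (Ne.symm h1)
  set w : ℂ := (t / hbar : ℝ) * ((1 + z) / (1 - z)) with hw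
  have h4 : (cayleyExp hbar t z - (1 - z)) * (1 - z) - (t / hbar : ℝ) * ((1 + z) * (1 - z))
      = (Complex.exp w - 1 - w) * (1 - z) ^ 2 := by
    have : w * (1 - z) = (t / hbar : ℝ) * (1 + z) := by
      rw [hw]; field_simp
    rw [cayleyExp, ← hw]
    linear_combination (1 - z) * this
  have h5 : ‖w‖ ^ 2 * ‖(1 - z) ^ 2‖ = (t / hbar) ^ 2 * ‖1 + z‖ ^ 2 := by
    rw [norm_pow, ← mul_pow, ← norm_mul]
    have : w * (1 - z) = (t / hbar : ℝ) * (1 + z) := by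
      rw [hw]; field_simp
    rw [this, norm_mul, mul_pow, Complex.norm_real, Real.norm_eq_abs, sq_abs]
  have h6 : ‖1 + z‖ ≤ 2 := by
    refine (norm_add_le _ _).trans ?_
    rw [norm_one, hz]; norm_num
  have h7 : w.re = 0 := by rw [hw, Complex.re_ofReal_mul, re_cayley_eq_zero hz, mul_zero]
  rw [h4, norm_mul]
  calc _ ≤ 3 * ‖w‖ ^ 2 * ‖(1 - z) ^ 2‖ :=
        mul_le_mul_of_nonneg_right (norm_exp_sub_one_sub_le h7) (norm_nonneg _)
    _ = 3 * ((t / hbar) ^ 2 * ‖1 + z‖ ^ 2) := by rw [mul_assoc, h5]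
    _ ≤ 3 * ((t / hbar) ^ 2 * 2 ^ 2) := by gcongr
    _ = _ := by ring

end CayleyExp

/-! ### Functional calculus of the Cayley transform -/

section CayleyCFC

variable {X : Type*} [NormedAddCommGroup X] [InnerProductSpace ℂ X] [CompleteSpace X]
  {C : X →L[ℂ] X} {hbar : ℝ}

theorem continuousOn_cayleyExp_spectrum (hC : C ∈ unitary (X →L[ℂ] X)) (t : ℝ) :
    ContinuousOn (cayleyExp hbar t) (spectrum ℂ C) :=
  (continuousOn_cayleyExp t).mono (spectrum.subset_circle_of_unitary hC)

theorem cfc_one_sub (hC : C ∈ unitary (X →L[ℂ] X)) : cfc (fun z : ℂ => 1 - z) C = 1 - C := by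
  have : IsStarNormal C := isStarNormal_of_mem_unitary hC
  rw [cfc_sub .., cfc_const_one ℂ C, cfc_id' ℂ C]

theorem cfc_one_add (hC : C ∈ unitary (X →L[ℂ] X)) : cfc (fun z : ℂ => 1 + z) C = 1 + C := by
  have : IsStarNormal C := isStarNormal_of_mem_unitary hC
  rw [cfc_add .., cfc_const_one ℂ C, cfc_id' ℂ C]

/-- On the spectrum `cayleyExp` and `1 - z` have the same modulus, so the two operators have the
same `T* T`. -/
theorem norm_cfc_cayleyExp_apply (hC : C ∈ unitary (X →L[ℂ] X)) (t : ℝ) (x : X) :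
    ‖cfc (cayleyExp hbar t) C x‖ = ‖(1 - C) x‖ := by
  have hcont := continuousOn_cayleyExp_spectrum (hbar := hbar) hC t
  have h1 : star (cfc (cayleyExp hbar t) C) * cfc (cayleyExp hbar t) C
      = star (1 - C) * (1 - C) := by
    rw [← cfc_one_sub hC, ← cfc_star, ← cfc_star, ← cfc_mul .., ← cfc_mul ..]
    refine cfc_congr fun z hz => ?_
    have hz1 := spectrum.norm_eq_one_of_unitary hC hz
    simp only [Complex.star_def, ← Complex.normSq_eq_conj_mul_self, Complex.normSq_eq_norm_sq,
      norm_cayleyExp t hz1]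
  have h2 := ContinuousLinearMap.apply_norm_sq_eq_inner_adjoint_right (cfc (cayleyExp hbar t) C) x
  have h3 := ContinuousLinearMap.apply_norm_sq_eq_inner_adjoint_right (1 - C) x
  rw [← ContinuousLinearMap.star_eq_adjoint] at h2 h3
  have h4 : ‖cfc (cayleyExp hbar t) C x‖ ^ 2 = ‖(1 - C) x‖ ^ 2 := by
    rw [h2, h3]
    change RCLike.re (inner ℂ x ((star (cfc (cayleyExp hbar t) C) * cfc (cayleyExp hbar t) C) x)) =
      RCLike.re (inner ℂ x ((star (1 - C) * (1 - C)) x))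
    rw [h1]
  exact (sq_eq_sq₀ (norm_nonneg _) (norm_nonneg _)).1 h4

theorem cfc_cayleyExp_mul (hC : C ∈ unitary (X →L[ℂ] X)) (s t : ℝ) :
    cfc (cayleyExp hbar s) C * cfc (cayleyExp hbar t) C
      = cfc (cayleyExp hbar (s + t)) C * (1 - C) := by
  have hs := continuousOn_cayleyExp_spectrum (hbar := hbar) hC s
  have ht := continuousOn_cayleyExp_spectrum (hbar := hbar) hC t
  have hst := continuousOn_cayleyExp_spectrum (hbar := hbar) hC (s + t)
  rw [← cfc_one_sub hC, ← cfc_mul .., ← cfc_mul ..]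
  exact congrArg (fun f => cfc f C) (funext fun z => cayleyExp_mul s t z)

theorem norm_cfc_cayleyExp_sub_le (hC : C ∈ unitary (X →L[ℂ] X)) (t : ℝ) :
    ‖(cfc (cayleyExp hbar t) C - (1 - C)) * (1 - C) - ((t / hbar : ℝ) : ℂ) • ((1 + C) * (1 - C))‖
      ≤ 12 * (t / hbar) ^ 2 := by
  have ht := continuousOn_cayleyExp_spectrum (hbar := hbar) hC t
  have : IsStarNormal C := isStarNormal_of_mem_unitary hC
  have h : (cfc (cayleyExp hbar t) C - (1 - C)) * (1 - C)
        - ((t / hbar : ℝ) : ℂ) • ((1 + C) * (1 - C))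
      = cfc (fun z => (cayleyExp hbar t z - (1 - z)) * (1 - z)
        - ((t / hbar : ℝ) : ℂ) * ((1 + z) * (1 - z))) C := by
    rw [← cfc_one_sub hC, ← cfc_one_add hC]
    have h1 : ContinuousOn (fun z : ℂ => 1 - z) (spectrum ℂ C) := by fun_prop
    have h2 : ContinuousOn (fun z : ℂ => 1 + z) (spectrum ℂ C) := by fun_prop
    have hd : ContinuousOn (fun z : ℂ => cayleyExp hbar t z - (1 - z)) (spectrum ℂ C) := ht.sub h1
    have hd' : ContinuousOn (fun z : ℂ => (cayleyExp hbar t z - (1 - z)) * (1 - z))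
        (spectrum ℂ C) := hd.mul h1
    have h3 : ContinuousOn (fun z : ℂ => (1 + z) * (1 - z)) (spectrum ℂ C) := h2.mul h1
    have h4 : ContinuousOn (fun z : ℂ => ((t / hbar : ℝ) : ℂ) * ((1 + z) * (1 - z)))
        (spectrum ℂ C) := continuousOn_const.mul h3
    rw [cfc_sub _ _ C hd' h4, cfc_mul _ _ C hd h1, cfc_sub _ _ C ht h1, cfc_const_mul _ _ C h3,
      cfc_mul _ _ C h2 h1]
  rw [h]
  exact norm_cfc_le (by positivity) fun z hz =>
    norm_cayleyExp_sub_le t (spectrum.norm_eq_one_of_unitary hC hz)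

end CayleyCFC

/-! ### Stone's theorem: existence of the unitary group -/

section Stone

variable {X : Type*} [NormedAddCommGroup X] [InnerProductSpace ℂ X]

theorem hasDerivAt_zero_of_norm_sub_le {f : ℝ → X} {f' : X} {K : ℝ}
    (h : ∀ t, ‖f t - f 0 - t • f'‖ ≤ K * t ^ 2) : HasDerivAt f f' 0 := by
  rw [hasDerivAt_iff_isLittleO_nhds_zero]
  have h1 : (fun t : ℝ => f (0 + t) - f 0 - t • f') =O[𝓝 0] fun t : ℝ => t ^ 2 := by
    refine Asymptotics.IsBigO.of_bound K (Eventually.of_forall fun t => ?_)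
    rw [zero_add]
    simpa using h t
  exact h1.trans_isLittleO (by simpa using Asymptotics.isLittleO_pow_pow (𝕜 := ℝ) one_lt_two)

theorem continuous_apply_of_dense {V : ℝ → (X →ₗᵢ[ℂ] X)} {s : Set X} (hs : Dense s)
    (h : ∀ x ∈ s, Continuous fun t => V t x) (x : X) : Continuous fun t => V t x := by
  refine continuous_of_uniform_approx_of_continuous fun u hu => ?_
  obtain ⟨ε, hε, hu⟩ := Metric.mem_uniformity_dist.1 hu
  obtain ⟨y, hy, hxy⟩ := Metric.dense_iff.1 hs x ε hε
  refine ⟨_, h y hxy, fun t => hu ?_⟩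
  rw [(V t).dist_map, dist_comm]
  exact hy

/-- Stone's theorem: a self-adjoint operator generates a unitary group. -/
theorem exists_isEvolutionGroup [CompleteSpace X] {hbar : ℝ} (hpos : 0 < hbar) {A : X →ₗ.[ℂ] X}
    (hA : IsSelfAdjoint A) : ∃ U : ℝ → (X ≃ₗᵢ[ℂ] X), IsEvolutionGroup hbar A U := by
  obtain ⟨C₀, hC₀⟩ := hA.exists_cayley
  let C : X →L[ℂ] X := C₀.toContinuousLinearEquiv
  have hC : C ∈ unitary (X →L[ℂ] X) := (Unitary.linearIsometryEquiv.symm C₀).2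
  have hCN : IsStarNormal C := isStarNormal_of_mem_unitary hC
  have hG : ∀ u, (u - C u, Complex.I • (u + C u)) ∈ A.graph := fun u => (hC₀ _).2 ⟨u, rfl⟩
  let D : X →L[ℂ] X := 1 - C
  have hDapp : ∀ u, D u = u - C u := fun u => rfl
  have hD : DenseRange D := by
    refine hA.dense_domain.mono ?_
    intro x hx
    obtain ⟨u, hu⟩ := (hC₀ (x, A ⟨x, hx⟩)).1 (A.mem_graph ⟨x, hx⟩)
    exact ⟨u, (congrArg Prod.fst hu).symm⟩
  have hcommC : ∀ t, Commute (cfc (cayleyExp hbar t) C) C := fun t =>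
    (Commute.refl C).cfc hCN.star_comm_self (cayleyExp hbar t)
  obtain ⟨U, hUD, hU0, hUadd⟩ := exists_unitaryGroup_of_mul hD
    (Q := fun t => cfc (cayleyExp hbar t) C)
    (fun t x => norm_cfc_cayleyExp_apply hC t x) (by rw [cayleyExp_zero]; exact cfc_one_sub hC)
    (fun t => ((Commute.one_right _).sub_right (hcommC t)).eq)
    (fun s t => cfc_cayleyExp_mul hC s t)
  have hUC : ∀ t x, U t (C x) = C (U t x) := by
    intro t x
    refine hD.induction_on x (isClosed_eq (by fun_prop) (by fun_prop)) fun x => ?_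
    have h1 : C (D x) = D (C x) := by simp [hDapp]
    rw [h1, hUD, hUD]
    exact congr($((hcommC t).eq) x)
  let V : ℝ → (X →ₗᵢ[ℂ] X) := fun t => (U t).toLinearIsometry
  have hV : IsIsometryGroup V := ⟨hU0, hUadd⟩
  -- The candidate core lies over the range of `D²`, not `D`: the quadratic estimate on the
  -- functional calculus needs both factors `1 - C`.
  let T : Set (X × X) := Set.range fun u => (D (D u), Complex.I • (D u + C (D u)))
  have hTA : T ⊆ A.graph := by
    rintro _ ⟨u, rfl⟩
    exact hG (D u)
  have hTV : T ⊆ generatorGraph hbar V := by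
    rintro _ ⟨u, rfl⟩
    refine hasDerivAt_zero_of_norm_sub_le (K := 12 / hbar ^ 2 * ‖u‖) fun t => ?_
    have h1 := ContinuousLinearMap.le_of_opNorm_le _
      (norm_cfc_cayleyExp_sub_le (hbar := hbar) hC t) u
    have hne : (hbar : ℂ) ≠ 0 := by exact_mod_cast hpos.ne'
    have h2 : U t (D (D u)) - U 0 (D (D u)) -
        t • (-(Complex.I / (hbar : ℂ))) • Complex.I • (D u + C (D u)) =
        ((cfc (cayleyExp hbar t) C - (1 - C)) * (1 - C)
          - ((t / hbar : ℝ) : ℂ) • ((1 + C) * (1 - C))) u := by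
      rw [hU0, hUD]
      have h3 : t • (-(Complex.I / (hbar : ℂ))) • Complex.I • (D u + C (D u)) =
          ((t / hbar : ℝ) : ℂ) • (D u + C (D u)) := by
        rw [← Complex.coe_smul, smul_smul, smul_smul]
        congr 1
        push_cast
        linear_combination (-(t : ℂ) / hbar) * Complex.I_mul_I
      rw [h3]
      rfl
    refine (h2 ▸ h1).trans (le_of_eq ?_)
    rw [div_pow]
    ring
  have hinv : ∀ p ∈ T, ∀ t, ∃ y, (V t p.1, y) ∈ T := by
    rintro _ ⟨u, rfl⟩ t
    refine ⟨_, U t u, Prod.ext ?_ rfl⟩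
    change D (D (U t u)) = U t (D (D u))
    simp only [hDapp, map_sub, hUC]
  have hdom : Dense (Prod.fst '' T) := by
    have : Prod.fst '' T = Set.range (D ∘ D) := by
      rw [← Set.range_comp]
      rfl
    rw [this]
    exact hD.comp hD D.continuous
  have hdense : (Submodule.span ℂ (Prod.fst '' T)).topologicalClosure = ⊤ :=
    Submodule.dense_iff_topologicalClosure_eq_top.1 (hdom.mono Submodule.subset_span)
  -- Both `A` and the generator are closed symmetric extensions of `T`, so both graphs equal the
  -- closed span of `T`.
  have hAT := hA.isSymmetricGraph.le_topologicalClosure_span hpos hV hTV hinv hdense hTA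
  have hVT := topologicalClosure_span_eq_generatorGraph hpos hV hTV hinv hdense
  have hTA' : (Submodule.span ℂ T).topologicalClosure ≤ A.graph :=
    Submodule.topologicalClosure_minimal _ (Submodule.span_le.2 hTA) hA.isClosed
  have hgen : A.graph = generatorGraph hbar V := hVT ▸ le_antisymm hAT hTA'
  refine ⟨U, hUadd, continuous_apply_of_dense (V := V) hA.dense_domain fun x hx => ?_,
    fun x y => by rw [hgen]; rfl⟩
  have h1 : (x, A ⟨x, hx⟩) ∈ generatorGraph hbar V := hgen ▸ A.mem_graph ⟨x, hx⟩
  exact continuous_iff_continuousAt.2 fun t =>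
    (hasDerivAt_of_mem_generatorGraph hV h1 t).continuousAt

end Stone

/-! ### Translations on `L²(ℝ; E)` -/

section Shift

variable {E : Type*} [NormedAddCommGroup E] [InnerProductSpace ℂ E]

/-- Translation by `t` on `L²(ℝ; E)`, that is `f ↦ f (· - t)`. -/
def shift (t : ℝ) : L2 E →ₗᵢ[ℂ] L2 E :=
  Lp.compMeasurePreservingₗᵢ ℂ (fun τ => τ - t) (measurePreserving_sub_right volume t)

theorem coeFn_shift (t : ℝ) (f : L2 E) : shift t f =ᵐ[volume] fun τ => f (τ - t) :=
  Lp.coeFn_compMeasurePreserving f (measurePreserving_sub_right volume t)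

theorem ae_sub_right {p : ℝ → Prop} (t : ℝ) (h : ∀ᵐ τ, p τ) : ∀ᵐ τ, p (τ - t) :=
  (measurePreserving_sub_right volume t).quasiMeasurePreserving.ae h

theorem isIsometryGroup_shift : IsIsometryGroup (shift (E := E)) := by
  refine ⟨fun f => Lp.ext ?_, fun s t f => Lp.ext ?_⟩
  · filter_upwards [coeFn_shift 0 f] with τ h
    rw [h, sub_zero]
  · filter_upwards [coeFn_shift (s + t) f, coeFn_shift s (shift t f),
      ae_sub_right s (coeFn_shift t f)] with τ h1 h2 h3
    rw [h1, h2, h3, sub_sub]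

theorem continuous_shift (f : L2 E) : Continuous fun t => shift t f := by
  let g : C(ℝ, C(ℝ, ℝ)) := ContinuousMap.curry ⟨fun p : ℝ × ℝ => p.2 - p.1, by fun_prop⟩
  exact Continuous.compMeasurePreservingLp (f := fun _ => f) (g := g) continuous_const
    g.continuous (fun t => measurePreserving_sub_right volume t) (by norm_num)

end Shift

/-! ### Pairing translates with test functions -/

section TestFunctions

theorem locallyIntegrable_L2 (f : L2 ℂ) : LocallyIntegrable (f : ℝ → ℂ) :=
  (Lp.memLp f).locallyIntegrable (by norm_num)

theorem L2_eq_zero_of_integral_eq_zero (h : L2 ℂ)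
    (H : ∀ φ : ℝ → ℝ, ContDiff ℝ ∞ φ → HasCompactSupport φ → ∫ τ, (φ τ : ℂ) * h τ = 0) :
    h = 0 := by
  apply Lp.ext
  have h1 := ae_eq_zero_of_integral_contDiff_smul_eq_zero (locallyIntegrable_L2 h)
    (fun φ h1 h2 => by simpa only [Complex.real_smul] using H φ h1 h2)
  filter_upwards [h1, Lp.coeFn_zero ℂ 2 (volume : Measure ℝ)] with τ h2 h3
  rw [h2, h3, Pi.zero_apply]

theorem exists_pairing {φ : ℝ → ℂ} (hφ : Continuous φ) (hc : HasCompactSupport φ) :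
    ∃ l : L2 ℂ →L[ℂ] ℂ, ∀ h, l h = ∫ τ, φ τ * h τ := by
  have h1 : MemLp (fun τ => (starRingEnd ℂ) (φ τ)) 2 (volume : Measure ℝ) :=
    (hφ.memLp_of_hasCompactSupport (p := 2) hc).star
  refine ⟨innerSL ℂ h1.toLp, fun h => ?_⟩
  rw [innerSL_apply_apply, L2.inner_def]
  refine integral_congr_ae ?_
  filter_upwards [h1.coeFn_toLp] with τ hτ
  rw [hτ, RCLike.inner_apply, starRingEnd_self_apply, mul_comm]

theorem integral_mul_shift (φ : ℝ → ℂ) (f : L2 ℂ) (t : ℝ) :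
    ∫ τ, φ τ * shift t f τ = ∫ τ, φ (τ + t) * f τ := by
  have h1 : (fun τ => φ τ * shift t f τ) =ᵐ[volume]
      fun τ => (fun σ => φ (σ + t) * f σ) (τ - t) := by
    filter_upwards [coeFn_shift t f] with τ h
    rw [h]
    simp
  rw [integral_congr_ae h1]
  exact integral_sub_right_eq_self (fun σ => φ (σ + t) * f σ) t

theorem hasDerivAt_integral_mul_shift {φ : ℝ → ℂ} (hφ : ContDiff ℝ ∞ φ)
    (hc : HasCompactSupport φ) (f : L2 ℂ) (t : ℝ) :
    HasDerivAt (fun t => ∫ τ, φ τ * shift t f τ) (∫ τ, deriv φ τ * shift t f τ) t := by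
  -- The pairing is the convolution of `f` with the reflected test function, evaluated at `-t`; the
  -- derivative can therefore fall on the smooth factor.
  have hφ' : ContDiff ℝ 1 fun s => φ (-s) := (hφ.of_le (by exact_mod_cast le_top)).comp contDiff_neg
  have hc' : HasCompactSupport fun s => φ (-s) :=
    hc.comp_homeomorph (Homeomorph.neg ℝ)
  have h1 := hc'.hasDerivAt_convolution_right (ContinuousLinearMap.mul ℝ ℂ)
    (locallyIntegrable_L2 f) hφ' (-t)
  have h2 := HasDerivAt.scomp t h1 (hasDerivAt_neg t)
  convert! h2 using 1
  · funext s
    simp only [Function.comp_def, convolution_def, ContinuousLinearMap.mul_apply',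
      integral_mul_shift]
    refine integral_congr_ae (Eventually.of_forall fun τ => ?_)
    simp only
    rw [mul_comm]
    congr 2
    ring
  · simp only [convolution_def, ContinuousLinearMap.mul_apply', integral_mul_shift, neg_smul,
      one_smul, ← integral_neg]
    refine integral_congr_ae (Eventually.of_forall fun τ => ?_)
    simp only [deriv_comp_neg]
    rw [show -(-t - τ) = τ + t by ring]
    ring

end TestFunctions

/-! ### The clock Hamiltonian generates translations -/

section Clock

variable {hbar : ℝ}

theorem mem_clockGraph {p : L2 ℂ × L2 ℂ} : p ∈ clockGraph hbar ↔
    ∀ φ : ℝ → ℂ, ContDiff ℝ ∞ φ → HasCompactSupport φ →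
      ∫ τ, (Complex.I * hbar) * deriv φ τ * p.1 τ = ∫ τ, φ τ * p.2 τ := Iff.rfl

theorem graph_clockHamiltonian : (clockHamiltonian hbar).graph = clockGraph hbar := by
  refine Submodule.toLinearPMap_graph_eq _ fun p hp h0 => ?_
  refine L2_eq_zero_of_integral_eq_zero _ fun φ hφ hc => ?_
  rw [← mem_clockGraph.1 hp (fun τ => (φ τ : ℂ)) (Complex.ofRealCLM.contDiff.comp hφ)
    (hc.comp_left Complex.ofReal_zero), h0]
  rw [integral_congr_ae (g := fun _ => (0 : ℂ)), integral_zero]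
  filter_upwards [Lp.coeFn_zero ℂ 2 (volume : Measure ℝ)] with τ h
  rw [h, Pi.zero_apply, mul_zero]

theorem shift_mem_clockGraph {p : L2 ℂ × L2 ℂ} (hp : p ∈ clockGraph hbar) (t : ℝ) :
    (shift t p.1, shift t p.2) ∈ clockGraph hbar := by
  intro φ hφ hc
  have h1 := mem_clockGraph.1 hp (fun τ => φ (τ + t)) (hφ.comp (contDiff_id.add contDiff_const))
    (hc.comp_homeomorph (Homeomorph.addRight t))
  simp only [deriv_comp_add_const] at h1
  simp only [integral_mul_shift]
  rw [← h1]

/-- Functions in the domain of the clock Hamiltonian are differentiable along translations. -/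
theorem clockGraph_le_generatorGraph (hpos : 0 < hbar) :
    clockGraph hbar ≤ generatorGraph hbar (shift (E := ℂ)) := by
  intro p hp
  have hne : (hbar : ℂ) ≠ 0 := by exact_mod_cast hpos.ne'
  set y : L2 ℂ := (-(Complex.I / (hbar : ℂ))) • p.2 with hy
  have hint : ∀ t, HasDerivAt (fun t => ∫ s in (0 : ℝ)..t, shift s y) (shift t y) t := fun t =>
    intervalIntegral.integral_hasDerivAt_right ((continuous_shift y).intervalIntegrable _ _)
      (continuous_shift y).aestronglyMeasurable.stronglyMeasurableAtFilter
      (continuous_shift y).continuousAt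
  -- Weak differentiability becomes strong through this integral formula: paired with any test
  -- function, both sides have the same derivative in `t` and agree at `0`. The fundamental theorem
  -- of calculus then differentiates the right side in norm.
  have key : ∀ t, shift t p.1 = p.1 + ∫ s in (0 : ℝ)..t, shift s y := by
    intro t
    rw [← sub_eq_zero]
    refine L2_eq_zero_of_integral_eq_zero _ fun φ hφ hc => ?_
    have hφ' : ContDiff ℝ ∞ fun τ => (φ τ : ℂ) := Complex.ofRealCLM.contDiff.comp hφ
    have hc' : HasCompactSupport fun τ => (φ τ : ℂ) := hc.comp_left Complex.ofReal_zero
    obtain ⟨l, hl⟩ := exists_pairing hφ'.continuous hc'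
    rw [← hl]
    have hd : ∀ t, HasDerivAt
        (fun t => l (shift t p.1 - (p.1 + ∫ s in (0 : ℝ)..t, shift s y))) 0 t := by
      intro t
      have h1 : HasDerivAt (fun t => l (shift t p.1)) (l (shift t y)) t := by
        have h2 := hasDerivAt_integral_mul_shift hφ' hc' p.1 t
        have h3 := mem_clockGraph.1 (shift_mem_clockGraph hp t) _ hφ' hc'
        simp only [hl]
        convert! h2 using 1
        rw [← hl, hy, map_smul, map_smul, hl, ← h3]
        simp only [mul_assoc, integral_const_mul]
        rw [smul_eq_mul]
        field_simp
        linear_combination -(∫ τ, deriv (fun τ => (φ τ : ℂ)) τ * (shift t p.1 : L2 ℂ) τ) *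
          Complex.I_sq
      have h4 := (l.restrictScalars ℝ).hasFDerivAt.comp_hasDerivAt t ((hint t).const_add p.1)
      have h5 := h1.sub h4
      simp only [ContinuousLinearMap.coe_restrictScalars', sub_self] at h5
      simp only [map_sub]
      exact h5
    have := is_const_of_deriv_eq_zero (fun t => (hd t).differentiableAt)
      (fun t => (hd t).deriv) t 0
    rw [this]
    simp [isIsometryGroup_shift.map_zero]
  rw [mem_generatorGraph]
  have h1 := (hint 0).const_add p.1
  rw [isIsometryGroup_shift.map_zero] at h1
  exact h1.congr_of_eventuallyEq (Eventually.of_forall key)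

/-- Integration by parts; this puts the test functions in the clock domain and so makes that domain
dense. -/
theorem toLp_mem_clockGraph {φ : ℝ → ℂ} (hφ : ContDiff ℝ ∞ φ) (hc : HasCompactSupport φ) :
    ∃ g, ((hφ.continuous.memLp_of_hasCompactSupport (p := 2) (μ := volume) hc).toLp φ, g)
      ∈ clockGraph hbar := by
  have hd : Continuous (deriv φ) := hφ.continuous_deriv (by simp)
  have hm := (hd.memLp_of_hasCompactSupport (p := 2) (μ := volume) hc.deriv)
  refine ⟨(-(Complex.I * hbar)) • hm.toLp (deriv φ), fun χ hχ hcχ => ?_⟩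
  have hdχ : Continuous (deriv χ) := hχ.continuous_deriv (by simp)
  have h1 : ∫ τ, χ τ * deriv φ τ = - ∫ τ, deriv χ τ * φ τ := by
    refine integral_mul_deriv_eq_deriv_mul_of_integrable
      (fun τ _ => (hχ.differentiable (by simp) τ).hasDerivAt)
      (fun τ _ => (hφ.differentiable (by simp) τ).hasDerivAt) ?_ ?_ ?_
    · exact (hχ.continuous.mul hd).integrable_of_hasCompactSupport hcχ.mul_right
    · exact (hdχ.mul hφ.continuous).integrable_of_hasCompactSupport hc.mul_left
    · exact (hχ.continuous.mul hφ.continuous).integrable_of_hasCompactSupport hcχ.mul_right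
  have e1 : (fun τ => (Complex.I * hbar) * deriv χ τ *
      ((hφ.continuous.memLp_of_hasCompactSupport (p := 2) (μ := volume) hc).toLp φ : L2 ℂ) τ)
      =ᵐ[volume] fun τ => (Complex.I * hbar) * (deriv χ τ * φ τ) := by
    filter_upwards [MemLp.coeFn_toLp
      (hφ.continuous.memLp_of_hasCompactSupport (p := 2) (μ := volume) hc)] with τ h
    rw [h, mul_assoc]
  have e2 : (fun τ => χ τ * ((-(Complex.I * hbar)) • hm.toLp (deriv φ) : L2 ℂ) τ)
      =ᵐ[volume] fun τ => (-(Complex.I * hbar)) * (χ τ * deriv φ τ) := by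
    filter_upwards [hm.coeFn_toLp, Lp.coeFn_smul (-(Complex.I * hbar)) (hm.toLp (deriv φ))]
      with τ h h'
    rw [h', Pi.smul_apply, h, smul_eq_mul]
    ring
  rw [integral_congr_ae e1, integral_congr_ae e2, integral_const_mul, integral_const_mul, h1]
  ring

theorem dense_domain_clockHamiltonian :
    Dense ((clockHamiltonian hbar).domain : Set (L2 ℂ)) := by
  rw [Submodule.dense_iff_topologicalClosure_eq_top, Submodule.topologicalClosure_eq_top_iff,
    Submodule.eq_bot_iff]
  intro h hh
  refine L2_eq_zero_of_integral_eq_zero _ fun φ hφ hc => ?_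
  have hφ' : ContDiff ℝ ∞ fun τ => (φ τ : ℂ) := Complex.ofRealCLM.contDiff.comp hφ
  have hc' : HasCompactSupport fun τ => (φ τ : ℂ) := hc.comp_left Complex.ofReal_zero
  obtain ⟨g, hg⟩ := toLp_mem_clockGraph (hbar := hbar) hφ' hc'
  rw [← graph_clockHamiltonian] at hg
  have h1 := (Submodule.mem_orthogonal _ _).1 hh _ (LinearPMap.mem_domain_of_mem_graph hg)
  rw [L2.inner_def] at h1
  rw [← h1]
  refine integral_congr_ae ?_
  filter_upwards [MemLp.coeFn_toLp
    (hφ'.continuous.memLp_of_hasCompactSupport (p := 2) (μ := volume) hc')] with τ hτ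
  rw [hτ, RCLike.inner_apply, Complex.conj_ofReal, mul_comm]

end Clock

/-! ### Fibrewise unitaries on `L²(ℝ; E)` -/

section Fiberwise

variable {E E' : Type*} [NormedAddCommGroup E] [InnerProductSpace ℂ E]
  [NormedAddCommGroup E'] [InnerProductSpace ℂ E']

/-- Isometry makes the family equicontinuous, which upgrades strong continuity to joint continuity;
measurability of `τ ↦ R τ (Φ τ)` and continuity of transformed test functions rest on this. -/
theorem continuous_uncurry_of_isometry {R : ℝ → (E ≃ₗᵢ[ℂ] E')}
    (hR : ∀ x, Continuous fun t => R t x) : Continuous fun p : ℝ × E => R p.1 p.2 := by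
  refine continuous_iff_continuousAt.2 fun p => ?_
  rw [ContinuousAt, tendsto_iff_dist_tendsto_zero]
  have h1 : Tendsto (fun q : ℝ × E => dist q.2 p.2 + dist (R q.1 p.2) (R p.1 p.2)) (𝓝 p) (𝓝 0) := by
    have : Continuous fun q : ℝ × E => dist q.2 p.2 + dist (R q.1 p.2) (R p.1 p.2) := by
      have := (hR p.2).comp (continuous_fst (X := ℝ) (Y := E))
      exact (continuous_snd.dist continuous_const).add (this.dist continuous_const)
    simpa using this.tendsto p
  refine squeeze_zero (fun _ => dist_nonneg) (fun q => ?_) h1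
  refine (dist_triangle _ (R q.1 p.2) _).trans ?_
  rw [(R q.1).dist_map]

theorem continuous_symm_of_isometry {R : ℝ → (E ≃ₗᵢ[ℂ] E')}
    (hR : ∀ x, Continuous fun t => R t x) (y : E') : Continuous fun t => (R t).symm y := by
  refine continuous_iff_continuousAt.2 fun t => ?_
  rw [ContinuousAt, tendsto_iff_dist_tendsto_zero]
  have h1 : Tendsto (fun s => dist (R s ((R t).symm y)) y) (𝓝 t) (𝓝 0) := by
    have : Continuous fun s => dist (R s ((R t).symm y)) y := (hR _).dist continuous_const
    simpa using this.tendsto t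
  refine h1.congr fun s => ?_
  rw [← (R s).dist_map ((R s).symm y), (R s).apply_symm_apply, dist_comm]

theorem memLp_fiberwise {R : ℝ → (E ≃ₗᵢ[ℂ] E')} (hR : ∀ x, Continuous fun t => R t x)
    (Φ : L2 E) : MemLp (fun τ => R τ (Φ τ)) 2 (volume : Measure ℝ) := by
  refine (Lp.memLp Φ).congr_norm ?_ (Eventually.of_forall fun τ => ((R τ).norm_map _).symm)
  exact (continuous_uncurry_of_isometry hR).comp_aestronglyMeasurable
    (aestronglyMeasurable_id.prodMk (Lp.aestronglyMeasurable Φ))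

/-- The operator `∫ |τ⟩⟨τ| ⊗ R(τ) dτ` of a strongly continuous family of unitaries. -/
def fiberwise (R : ℝ → (E ≃ₗᵢ[ℂ] E')) (hR : ∀ x, Continuous fun t => R t x) :
    L2 E ≃ₗᵢ[ℂ] L2 E' where
  toFun Φ := (memLp_fiberwise hR Φ).toLp _
  invFun Φ := (memLp_fiberwise (R := fun t => (R t).symm) (continuous_symm_of_isometry hR) Φ).toLp _
  map_add' Φ Ψ := by
    apply Lp.ext
    filter_upwards [(memLp_fiberwise hR (Φ + Ψ)).coeFn_toLp, (memLp_fiberwise hR Φ).coeFn_toLp,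
      (memLp_fiberwise hR Ψ).coeFn_toLp, Lp.coeFn_add Φ Ψ,
      Lp.coeFn_add ((memLp_fiberwise hR Φ).toLp _) ((memLp_fiberwise hR Ψ).toLp _)]
      with τ h1 h2 h3 h4 h5
    rw [h1, h5, Pi.add_apply, h2, h3, h4, Pi.add_apply, map_add]
  map_smul' c Φ := by
    apply Lp.ext
    filter_upwards [(memLp_fiberwise hR (c • Φ)).coeFn_toLp, (memLp_fiberwise hR Φ).coeFn_toLp,
      Lp.coeFn_smul c Φ, Lp.coeFn_smul c ((memLp_fiberwise hR Φ).toLp _)]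
      with τ h1 h2 h3 h4
    rw [h1, RingHom.id_apply, h4, Pi.smul_apply, h2, h3, Pi.smul_apply, map_smul]
  left_inv Φ := by
    apply Lp.ext
    filter_upwards [(memLp_fiberwise hR Φ).coeFn_toLp,
      (memLp_fiberwise (R := fun t => (R t).symm) (continuous_symm_of_isometry hR)
        ((memLp_fiberwise hR Φ).toLp _)).coeFn_toLp] with τ h1 h2
    rw [h2, h1, (R τ).symm_apply_apply]
  right_inv Φ := by
    apply Lp.ext
    filter_upwards [(memLp_fiberwise (R := fun t => (R t).symm)
        (continuous_symm_of_isometry hR) Φ).coeFn_toLp,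
      (memLp_fiberwise hR ((memLp_fiberwise (R := fun t => (R t).symm)
        (continuous_symm_of_isometry hR) Φ).toLp _)).coeFn_toLp] with τ h1 h2
    rw [h2, h1, (R τ).apply_symm_apply]
  norm_map' Φ := by
    have h : ∀ᵐ τ, ‖((memLp_fiberwise hR Φ).toLp _ : L2 E') τ‖ = ‖Φ τ‖ := by
      filter_upwards [(memLp_fiberwise hR Φ).coeFn_toLp] with τ h1
      rw [h1, (R τ).norm_map]
    exact le_antisymm (Lp.norm_le_norm_of_ae_le (h.mono fun _ h => h.le))
      (Lp.norm_le_norm_of_ae_le (h.mono fun _ h => h.ge))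

theorem isClockIntegral_fiberwise {R : ℝ → (E ≃ₗᵢ[ℂ] E')} (hR : ∀ x, Continuous fun t => R t x) :
    IsClockIntegral (fiberwise R hR) R :=
  fun Φ => (memLp_fiberwise hR Φ).coeFn_toLp

theorem isClockIntegral_fiberwise_symm {R : ℝ → (E ≃ₗᵢ[ℂ] E')}
    (hR : ∀ x, Continuous fun t => R t x) :
    IsClockIntegral (fiberwise R hR).symm fun τ => (R τ).symm :=
  fun Φ => (memLp_fiberwise (R := fun t => (R t).symm) (continuous_symm_of_isometry hR) Φ).coeFn_toLp

end Fiberwise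

/-! ### Product vectors as a bounded bilinear map -/

section PureTensor

variable {E : Type*} [NormedAddCommGroup E] [InnerProductSpace ℂ E]

theorem norm_pureTensor (f : L2 ℂ) (x : E) : ‖pureTensor f x‖ = ‖f‖ * ‖x‖ := by
  have h := inner_pureTensor f f x x
  rw [inner_self_eq_norm_sq_to_K, inner_self_eq_norm_sq_to_K, inner_self_eq_norm_sq_to_K,
    ← mul_pow] at h
  have h1 : ‖pureTensor f x‖ ^ 2 = (‖f‖ * ‖x‖) ^ 2 := by exact_mod_cast h
  exact (sq_eq_sq₀ (norm_nonneg _) (by positivity)).1 h1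

/-- The product vector as a continuous bilinear map. -/
def pureTensorL : L2 ℂ →L[ℂ] E →L[ℂ] L2 E :=
  LinearMap.mkContinuous₂
    (LinearMap.mk₂ ℂ pureTensor
      (fun f g x => by
        apply Lp.ext
        filter_upwards [pureTensor_coe (f + g) x, pureTensor_coe f x, pureTensor_coe g x,
          Lp.coeFn_add f g, Lp.coeFn_add (pureTensor f x) (pureTensor g x)] with τ h1 h2 h3 h4 h5
        rw [h1, h5, Pi.add_apply, h2, h3, h4, Pi.add_apply, add_smul])
      (fun c f x => by
        apply Lp.ext
        filter_upwards [pureTensor_coe (c • f) x, pureTensor_coe f x,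
          Lp.coeFn_smul c f, Lp.coeFn_smul c (pureTensor f x)] with τ h1 h2 h3 h4
        rw [h1, h4, Pi.smul_apply, h2, h3, Pi.smul_apply, smul_assoc])
      (fun f x y => by
        apply Lp.ext
        filter_upwards [pureTensor_coe f (x + y), pureTensor_coe f x, pureTensor_coe f y,
          Lp.coeFn_add (pureTensor f x) (pureTensor f y)] with τ h1 h2 h3 h4
        rw [h1, h4, Pi.add_apply, h2, h3, smul_add])
      (fun c f x => by
        apply Lp.ext
        filter_upwards [pureTensor_coe f (c • x), pureTensor_coe f x,
          Lp.coeFn_smul c (pureTensor f x)] with τ h1 h2 h3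
        rw [h1, h3, Pi.smul_apply, h2, smul_comm]))
    1 (fun f x => by
      rw [one_mul]
      exact (norm_pureTensor f x).le)

end PureTensor

/-! ### The total Hamiltonian as a generator -/

section TotalEvolution

variable {E : Type*} [NormedAddCommGroup E] [InnerProductSpace ℂ E]
  {hbar : ℝ} {A : E →ₗ.[ℂ] E} {U : ℝ → (E ≃ₗᵢ[ℂ] E)}

theorem IsEvolutionGroup.map_zero (hU : IsEvolutionGroup hbar A U) (x : E) : U 0 x = x := by
  have := hU.map_add 0 0 x
  rw [add_zero] at this
  exact ((U 0).injective this).symm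

theorem IsEvolutionGroup.isIsometryGroup (hU : IsEvolutionGroup hbar A U) :
    IsIsometryGroup fun t => (U t).toLinearIsometry :=
  ⟨hU.map_zero, hU.map_add⟩

theorem IsEvolutionGroup.graph_eq (hU : IsEvolutionGroup hbar A U) :
    A.graph = generatorGraph hbar fun t => (U t).toLinearIsometry := by
  ext ⟨x, y⟩
  exact hU.generator x y

/-- The unitary group generated by the total Hamiltonian. -/
def totalEvolution (U : ℝ → (E ≃ₗᵢ[ℂ] E)) (t : ℝ) : L2 E →ₗᵢ[ℂ] L2 E :=
  (fiberwise (fun _ => U t) fun _ => continuous_const).toLinearIsometry.comp (shift t)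

theorem coeFn_totalEvolution (U : ℝ → (E ≃ₗᵢ[ℂ] E)) (t : ℝ) (Φ : L2 E) :
    totalEvolution U t Φ =ᵐ[volume] fun τ => U t (Φ (τ - t)) := by
  filter_upwards [isClockIntegral_fiberwise (R := fun _ => U t) (fun _ => continuous_const)
    (shift t Φ), coeFn_shift t Φ] with τ h1 h2
  rw [← h2, ← h1]
  rfl

theorem totalEvolution_pureTensor (U : ℝ → (E ≃ₗᵢ[ℂ] E)) (t : ℝ) (f : L2 ℂ) (x : E) :
    totalEvolution U t (pureTensor f x) = pureTensor (shift t f) (U t x) := by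
  apply Lp.ext
  filter_upwards [coeFn_totalEvolution U t (pureTensor f x), ae_sub_right t (pureTensor_coe f x),
    pureTensor_coe (shift t f) (U t x), coeFn_shift t f] with τ h1 h2 h3 h4
  rw [h1, h2, h3, h4, map_smul]

theorem IsEvolutionGroup.isIsometryGroup_totalEvolution (hU : IsEvolutionGroup hbar A U) :
    IsIsometryGroup (totalEvolution U) := by
  refine ⟨fun f => Lp.ext ?_, fun s t f => Lp.ext ?_⟩
  · filter_upwards [coeFn_totalEvolution U 0 f] with τ h
    rw [h, sub_zero, hU.map_zero]
  · filter_upwards [coeFn_totalEvolution U (s + t) f,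
      coeFn_totalEvolution U s (totalEvolution U t f),
      ae_sub_right s (coeFn_totalEvolution U t f)] with τ h1 h2 h3
    rw [h1, h2, h3, sub_sub, hU.map_add]

/-- The total Hamiltonian is the generator of the total evolution. -/
theorem IsEvolutionGroup.graph_totalHamiltonian [CompleteSpace E] (hpos : 0 < hbar)
    (hA : Dense (A.domain : Set E)) (hU : IsEvolutionGroup hbar A U) :
    (totalHamiltonian hbar A).graph = generatorGraph hbar (totalEvolution U) := by
  have hV := hU.isIsometryGroup_totalEvolution
  set T : Set (L2 E × L2 E) := {p : L2 E × L2 E |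
    ∃ (f : (clockHamiltonian hbar).domain) (x : A.domain),
      p = (pureTensor (f : L2 ℂ) (x : E),
        pureTensor (clockHamiltonian hbar f) (x : E) + pureTensor (f : L2 ℂ) (A x))} with hTdef
  have hTV : T ⊆ generatorGraph hbar (totalEvolution U) := by
    rintro _ ⟨f, x, rfl⟩
    have hf : HasDerivAt (fun t => shift t (f : L2 ℂ))
        ((-(Complex.I / (hbar : ℂ))) • clockHamiltonian hbar f) 0 :=
      clockGraph_le_generatorGraph hpos
        (graph_clockHamiltonian (hbar := hbar) ▸ (clockHamiltonian hbar).mem_graph f)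
    have hx := (hU.generator x (A x)).1 (A.mem_graph x)
    -- On `f ⊗ x` the total evolution is `shift t f ⊗ U t x`, and the product rule for the bilinear
    -- tensor map yields `H_c f ⊗ x + f ⊗ A x`.
    have hB := (pureTensorL (E := E)).isBoundedBilinearMap
    have h1 := ((hB.hasFDerivAt (shift 0 (f : L2 ℂ), U 0 (x : E))).restrictScalars
      ℝ).comp_hasDerivAt (0 : ℝ) (hf.prodMk hx)
    have h2 : (-(Complex.I / (hbar : ℂ))) •
        (pureTensor (clockHamiltonian hbar f) (x : E) + pureTensor (f : L2 ℂ) (A x)) =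
        pureTensorL (shift 0 (f : L2 ℂ)) ((-(Complex.I / (hbar : ℂ))) • A x)
        + pureTensorL ((-(Complex.I / (hbar : ℂ))) • clockHamiltonian hbar f) (U 0 (x : E)) := by
      rw [isIsometryGroup_shift.map_zero, hU.map_zero, map_smul, map_smul,
        _root_.smul_apply, ← smul_add, add_comm]
      rfl
    rw [SetLike.mem_coe, mem_generatorGraph]
    rw [h2]
    simp only [totalEvolution_pureTensor]
    exact h1
  have hinv : ∀ p ∈ T, ∀ t, ∃ y, (totalEvolution U t p.1, y) ∈ T := by
    rintro _ ⟨f, x, rfl⟩ t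
    have hf : shift t (f : L2 ℂ) ∈ (clockHamiltonian hbar).domain := by
      have := (clockHamiltonian hbar).mem_graph f
      rw [graph_clockHamiltonian] at this
      have := shift_mem_clockGraph this t
      rw [← graph_clockHamiltonian] at this
      exact LinearPMap.mem_domain_of_mem_graph this
    have hx : U t (x : E) ∈ A.domain := by
      have := A.mem_graph x
      rw [hU.graph_eq] at this
      have := map_mem_generatorGraph hU.isIsometryGroup this t
      rw [← hU.graph_eq] at this
      exact LinearPMap.mem_domain_of_mem_graph this
    exact ⟨_, ⟨_, hf⟩, ⟨_, hx⟩, Prod.ext (totalEvolution_pureTensor U t f x) rfl⟩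
  have hdense : (Submodule.span ℂ (Prod.fst '' T)).topologicalClosure = ⊤ := by
    set K := (Submodule.span ℂ (Prod.fst '' T)).topologicalClosure
    have hK : IsClosed (K : Set (L2 E)) := Submodule.isClosed_topologicalClosure _
    have h1 : ∀ f : L2 ℂ, ∀ x : E, pureTensor f x ∈ K := by
      intro f x
      refine dense_domain_clockHamiltonian (hbar := hbar) |>.induction
        (P := fun f => pureTensor f x ∈ K) (fun f hf => ?_)
        (hK.preimage (f := fun f => pureTensor f x) (pureTensorL.flip x).continuous) f
      refine hA.induction (P := fun x => pureTensor f x ∈ K) (fun x hx => ?_)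
        (hK.preimage (f := fun x => pureTensor f x) (pureTensorL f).continuous) x
      exact Submodule.le_topologicalClosure _ (Submodule.subset_span
        ⟨_, ⟨⟨f, hf⟩, ⟨x, hx⟩, rfl⟩, rfl⟩)
    rw [← top_le_iff, ← Submodule.dense_iff_topologicalClosure_eq_top.1
      (dense_span_pureTensor (E := E))]
    refine Submodule.topologicalClosure_minimal _ (Submodule.span_le.2 ?_) hK
    rintro _ ⟨f, x, rfl⟩
    exact h1 f x
  have heq := topologicalClosure_span_eq_generatorGraph hpos hV hTV hinv hdense
  -- The closure is the graph of an operator only if it is single-valued; inside a generator graph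
  -- this is uniqueness of the derivative of a constant orbit.
  have h0 : (totalHamiltonian hbar A).graph = (Submodule.span ℂ T).topologicalClosure := by
    refine Submodule.toLinearPMap_graph_eq _ fun p hp h0 => ?_
    have hp' : p ∈ (Submodule.span ℂ T).topologicalClosure := hp
    rw [heq, mem_generatorGraph, h0] at hp'
    simp only [_root_.map_zero] at hp'
    have hne : (hbar : ℂ) ≠ 0 := by exact_mod_cast hpos.ne'
    simpa [hne] using hp'.unique (hasDerivAt_const _ _)
  rw [h0, heq]

end TotalEvolution

/-! ### Transitivity of the unitary group on spheres -/

section Transitivity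

variable {E : Type*} [NormedAddCommGroup E] [InnerProductSpace ℂ E]

theorem exists_phase (z : ℂ) : ∃ c : ℂ, ‖c‖ = 1 ∧ (c * z).im = 0 := by
  refine ⟨Complex.exp ((-z.arg : ℝ) * Complex.I), Complex.norm_exp_ofReal_mul_I _, ?_⟩
  have h : Complex.exp ((-z.arg : ℝ) * Complex.I) * z = ‖z‖ := by
    calc _ = Complex.exp ((-z.arg : ℝ) * Complex.I) * (‖z‖ * Complex.exp (z.arg * Complex.I)) := by
          rw [Complex.norm_mul_exp_arg_mul_I]
      _ = ‖z‖ := by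
          rw [mul_left_comm, ← Complex.exp_add]
          simp
  rw [h, Complex.ofReal_im]

/-- The unitary group acts transitively on the unit sphere. -/
theorem exists_unitary_map_eq {v w : E} (h : ‖v‖ = ‖w‖) : ∃ S : E ≃ₗᵢ[ℂ] E, S v = w := by
  obtain ⟨c, hc, him⟩ := exists_phase (inner ℂ w v)
  have hc0 : c ≠ 0 := by
    rw [← norm_pos_iff, hc]; exact one_pos
  let P : E ≃ₗᵢ[ℂ] E :=
    { LinearEquiv.smulOfNeZero ℂ E c hc0 with
      norm_map' := fun x => by
        change ‖c • x‖ = ‖x‖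
        rw [norm_smul, hc, one_mul] }
  set u : E := c • v with hu
  have hPv : P v = u := rfl
  have hnorm : ‖u‖ = ‖w‖ := by rw [hu, norm_smul, hc, one_mul, h]
  have hreal : inner ℂ u w = inner ℂ w u := by
    rw [← inner_conj_symm u w, Complex.conj_eq_iff_im, hu, inner_smul_right]
    exact him
  -- After the phase correction `⟨w, u⟩` is real, so equal norms give `u - w ⊥ u + w`, and this
  -- reflection exchanges `u` and `w`.
  let ρ := (ℂ ∙ (u - w))ᗮ.reflection
  have h1 : ρ (u - w) = -(u - w) := Submodule.reflection_orthogonalComplement_singleton_eq_neg _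
  have h2 : ρ (u + w) = u + w := by
    refine Submodule.reflection_mem_subspace_eq_self ?_
    rw [Submodule.mem_orthogonal_singleton_iff_inner_right, inner_sub_left, inner_add_right,
      inner_add_right, inner_self_eq_norm_sq_to_K, inner_self_eq_norm_sq_to_K, hnorm, hreal]
    ring
  refine ⟨P.trans ρ, ?_⟩
  rw [LinearIsometryEquiv.trans_apply, hPv]
  rw [map_sub] at h1
  rw [map_add] at h2
  have h3 : (2 : ℂ) • ρ u = (2 : ℂ) • w := by
    have : ρ u + ρ u = w + w := by
      have h4 : ρ u = -(u - w) + ρ w := by rw [← h1]; abel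
      have h5 : ρ u = u + w - ρ w := by rw [← h2]; abel
      calc ρ u + ρ u = (-(u - w) + ρ w) + (u + w - ρ w) := by rw [← h4, ← h5]
        _ = w + w := by abel
    rw [two_smul, two_smul, this]
  exact smul_right_injective E (two_ne_zero (α := ℂ)) h3

end Transitivity

/-! ### Fibrewise unitaries on test vectors -/

section Rigged

variable {E E' : Type*} [NormedAddCommGroup E] [InnerProductSpace ℂ E]
  [NormedAddCommGroup E'] [InnerProductSpace ℂ E']

theorem IsClockIntegral.exists_testVector {S : L2 E ≃ₗᵢ[ℂ] L2 E'} {R : ℝ → (E ≃ₗᵢ[ℂ] E')}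
    (hS : IsClockIntegral S R) (hR : ∀ x, Continuous fun t => R t x) (Φ : C_c(ℝ, E)) :
    ∃ Φ' : C_c(ℝ, E'), testVector Φ' = S (testVector Φ) ∧ ∀ τ, Φ' τ = R τ (Φ τ) := by
  let Φ' : C_c(ℝ, E') :=
    { toFun := fun τ => R τ (Φ τ)
      continuous_toFun :=
        (continuous_uncurry_of_isometry hR).comp (continuous_id.prodMk Φ.continuous)
      hasCompactSupport' := Φ.hasCompactSupport.mono fun τ hτ h0 => hτ (by simp [h0]) }
  have hΦ' : ∀ τ, Φ' τ = R τ (Φ τ) := fun τ => rfl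
  refine ⟨Φ', Lp.ext ?_, hΦ'⟩
  filter_upwards [hS (testVector Φ),
    (Φ.continuous.memLp_of_hasCompactSupport (p := 2) (μ := volume)
      Φ.hasCompactSupport).coeFn_toLp,
    (Φ'.continuous.memLp_of_hasCompactSupport (p := 2) (μ := volume)
      Φ'.hasCompactSupport).coeFn_toLp] with τ h1 h2 h3
  rw [h1]
  exact h3.trans ((hΦ' τ).trans (congrArg (R τ) h2.symm))

end Rigged

/-! ### Commutation with the Hamiltonian and the equivalence -/

section Main

variable {E : Type*} [NormedAddCommGroup E] [InnerProductSpace ℂ E] [CompleteSpace E]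

/-- A bounded operator commuting with the group can be pulled through the derivative of an orbit;
applying this to `S` and to its inverse gives both directions. -/
theorem intertwines_of_commute {X : Type*} [NormedAddCommGroup X] [InnerProductSpace ℂ X]
    {hbar : ℝ} {V : ℝ → (X →ₗᵢ[ℂ] X)} {H : X →ₗ.[ℂ] X} (hH : H.graph = generatorGraph hbar V)
    {S : X ≃ₗᵢ[ℂ] X} (hS : ∀ t x, V t (S x) = S (V t x)) : Intertwines S H H := by
  have key : ∀ W : X ≃ₗᵢ[ℂ] X, (∀ t x, V t (W x) = W (V t x)) → ∀ p ∈ generatorGraph hbar V,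
      (W p.1, W p.2) ∈ generatorGraph hbar V := by
    intro W hW p hp
    have h1 := ((W.toContinuousLinearEquiv : X →L[ℂ] X).restrictScalars
      ℝ).hasFDerivAt.comp_hasDerivAt (0 : ℝ) (mem_generatorGraph.1 hp)
    rw [mem_generatorGraph]
    simp only [hW]
    rw [← map_smul W]
    exact h1
  intro x y
  rw [hH]
  refine ⟨fun h => key S hS _ h, fun h => ?_⟩
  have := key S.symm (fun t x => by
    rw [← S.injective.eq_iff, ← hS, S.apply_symm_apply, S.apply_symm_apply]) _ h
  simpa using this

theorem PWSystem.isEvolutionGroup_restEvolution {hbar : ℝ} (hpos : 0 < hbar) (P : PWSystem E) :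
    IsEvolutionGroup hbar P.restHamiltonian (P.restEvolution hbar) := by
  have h := exists_isEvolutionGroup hpos P.selfAdjoint
  unfold PWSystem.restEvolution evolution
  rw [dif_pos h]
  exact h.choose_spec

variable {hbar : ℝ} {P : PWSystem E}

theorem PWSystem.continuous_conjEvolution (hpos : 0 < hbar) (S₀ : E ≃ₗᵢ[ℂ] E) (x : E) :
    Continuous fun t => P.conjEvolution hbar S₀ t x := by
  have hU := P.isEvolutionGroup_restEvolution hpos
  exact (continuous_uncurry_of_isometry hU.continuous_orbit).comp
    (continuous_id.prodMk (S₀.continuous.comp ((hU.continuous_orbit x).comp continuous_neg)))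

/-- `S_τ U_t = U_t S_{τ - t}`. -/
theorem PWSystem.conjEvolution_restEvolution (hpos : 0 < hbar) (S₀ : E ≃ₗᵢ[ℂ] E) (τ t : ℝ)
    (x : E) : P.conjEvolution hbar S₀ τ (P.restEvolution hbar t x)
      = P.restEvolution hbar t (P.conjEvolution hbar S₀ (τ - t) x) := by
  have hU := P.isEvolutionGroup_restEvolution hpos
  change P.restEvolution hbar τ (S₀ (P.restEvolution hbar (-τ) (P.restEvolution hbar t x))) =
    P.restEvolution hbar t (P.restEvolution hbar (τ - t)
      (S₀ (P.restEvolution hbar (-(τ - t)) x)))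
  rw [← hU.map_add, ← hU.map_add]
  congr 2 <;> ring_nf

theorem PWSystem.IsHistory.conjEvolution_apply {ψ ψ' : ℝ → E}
    (hψ : P.IsHistory hbar ψ) (hψ' : P.IsHistory hbar ψ') {S₀ : E ≃ₗᵢ[ℂ] E}
    (hS₀ : S₀ (ψ 0) = ψ' 0) (τ : ℝ) : P.conjEvolution hbar S₀ τ (ψ τ) = ψ' τ := by
  have h1 := hψ.evolves τ 0
  have h2 := hψ'.evolves 0 τ
  rw [zero_sub] at h1
  rw [sub_zero] at h2
  rw [h2, ← hS₀, h1]
  rfl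

theorem PWSystem.intertwines_fiberwise_conjEvolution (hpos : 0 < hbar) (S₀ : E ≃ₗᵢ[ℂ] E)
    (hR : ∀ x, Continuous fun t => P.conjEvolution hbar S₀ t x) :
    Intertwines (fiberwise (P.conjEvolution hbar S₀) hR) (P.hamiltonian hbar)
      (P.hamiltonian hbar) := by
  have hU := P.isEvolutionGroup_restEvolution hpos
  have hgraph : (P.hamiltonian hbar).graph
      = generatorGraph hbar (totalEvolution (P.restEvolution hbar)) :=
    hU.graph_totalHamiltonian hpos P.selfAdjoint.dense_domain
  have hS := isClockIntegral_fiberwise hR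
  set S := fiberwise (P.conjEvolution hbar S₀) hR
  have hcomm : ∀ t (Φ : L2 E), totalEvolution (P.restEvolution hbar) t (S Φ)
      = S (totalEvolution (P.restEvolution hbar) t Φ) := by
    intro t Φ
    apply Lp.ext
    filter_upwards [coeFn_totalEvolution (P.restEvolution hbar) t (S Φ),
      hS (totalEvolution (P.restEvolution hbar) t Φ),
      coeFn_totalEvolution (P.restEvolution hbar) t Φ, ae_sub_right t (hS Φ)] with τ h1 h2 h3 h4
    rw [h1, h2, h3, h4, PWSystem.conjEvolution_restEvolution hpos]
  exact intertwines_of_commute hgraph hcomm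

theorem PWSystem.IsHistory.isBareEquivalence (hpos : 0 < hbar) {ψ ψ' : ℝ → E}
    (hψ : P.IsHistory hbar ψ) (hψ' : P.IsHistory hbar ψ') {S₀ : E ≃ₗᵢ[ℂ] E}
    (hS₀ : S₀ (ψ 0) = ψ' 0) :
    PWSystem.IsBareEquivalence hbar P ψ P ψ' (fiberwise (P.conjEvolution hbar S₀)
      (PWSystem.continuous_conjEvolution hpos S₀)) := by
  have hR := PWSystem.continuous_conjEvolution (P := P) hpos S₀
  have hS := isClockIntegral_fiberwise hR
  have hS' := isClockIntegral_fiberwise_symm hR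
  have hR' := continuous_symm_of_isometry hR
  -- Unitarity of each fibre moves `S_τ⁻¹` across the inner product; this single identity gives the
  -- temporal states directly and the timeless state under the integral.
  have hket : ∀ τ (y : E), inner ℂ ((P.conjEvolution hbar S₀ τ).symm y) (ψ τ)
      = inner ℂ y (ψ' τ) := by
    intro τ y
    rw [← (P.conjEvolution hbar S₀ τ).inner_map_map, LinearIsometryEquiv.apply_symm_apply,
      hψ.conjEvolution_apply hψ' hS₀]
  refine ⟨PWSystem.intertwines_fiberwise_conjEvolution hpos S₀ hR,
    ⟨fun Φ => ?_, fun Φ => ?_⟩, fun τ Φ => ?_, fun Φ => ?_⟩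
  · obtain ⟨Φ', h, -⟩ := hS.exists_testVector hR Φ
    exact ⟨Φ', h⟩
  · obtain ⟨Φ', h, -⟩ := hS'.exists_testVector hR' Φ
    exact ⟨Φ', h⟩
  · obtain ⟨Φ', h, h'⟩ := hS'.exists_testVector hR' Φ
    refine ⟨Φ', h, ?_⟩
    rw [ket, ket, h', hket]
  · obtain ⟨Φ', h, h'⟩ := hS'.exists_testVector hR' Φ
    refine ⟨Φ', h, ?_⟩
    simp only [timelessState, ket, h', hket]

end Main

end PageWootters

end

theorem mainTheorem5 {E : Type*} [NormedAddCommGroup E] [InnerProductSpace ℂ E] [CompleteSpace E]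
    [TopologicalSpace.SeparableSpace E] (hbar : ℝ) (hbar_pos : 0 < hbar)
    (P : PageWootters.PWSystem E) (ψ ψ' : ℝ → E)
    (hψ : P.IsHistory hbar ψ) (hψ' : P.IsHistory hbar ψ') :
    PageWootters.PWSystem.BareEquivalent hbar P ψ P ψ' ∧
    (∃ S₀ : E ≃ₗᵢ[ℂ] E, S₀ (ψ 0) = ψ' 0) ∧
    ∀ S₀ : E ≃ₗᵢ[ℂ] E, S₀ (ψ 0) = ψ' 0 →
      ∃ S : PageWootters.L2 E ≃ₗᵢ[ℂ] PageWootters.L2 E,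
        PageWootters.IsClockIntegral S (P.conjEvolution hbar S₀) ∧
        PageWootters.Intertwines S (P.hamiltonian hbar) (P.hamiltonian hbar) ∧
        (∀ τ : ℝ, PageWootters.MapsGen S
          (PageWootters.ket τ (ψ τ)) (PageWootters.ket τ (ψ' τ))) ∧
        PageWootters.PWSystem.IsBareEquivalence hbar P ψ P ψ' S := by
  have hex : ∃ S₀ : E ≃ₗᵢ[ℂ] E, S₀ (ψ 0) = ψ' 0 :=
    PageWootters.exists_unitary_map_eq ((hψ.unit 0).trans (hψ'.unit 0).symm)
  refine ⟨?_, hex, fun S₀ hS₀ => ?_⟩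
  · obtain ⟨S₀, hS₀⟩ := hex
    exact ⟨_, hψ.isBareEquivalence hbar_pos hψ' hS₀⟩
  · have h := hψ.isBareEquivalence hbar_pos hψ' hS₀
    exact ⟨_, PageWootters.isClockIntegral_fiberwise _, h.law, h.temporal, h⟩
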